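/- Let $m\ge 1$ be an integer. Let $\mathcal{C}\ell_m^{\mathbb R}$ and $\mathcal{C}\ell_m^{\mathbb C}$ be the real and the complex Clifford algebra with generators $e_1,\dots,e_m$, $e_ie_j+e_je_i=0$ for $i\ne j$ and $e_j^2=-1$. For $a=\sum_A a_Ae_A$ put $a^\dagger=\sum_A \overline{a_A}\,(-1)^{|A|(|A|+1)/2}e_A$ and $|a|_0^2=\sum_A|a_A|^2$. For a measure $\mu$, the right Clifford module $L^2(\mu)$ of square-integrable Clifford algebra-valued functions carries the Clifford algebra-valued inner product $\langle F,G\rangle=\int F^\dagger G\,d\mu$. A family $(\psi_i)$ in $L^2(\mu)$ is orthonormal if $\langle\psi_i,\psi_{i'}\rangle=\delta_{i,i'}$; it is an orthonormal basis of a closed right submodule $M$ if moreover all $\psi_i$ lie in $M$ and $F=\sum_i\psi_i\langle\psi_i,F\rangle$ (unconditional convergence in norm) for every $F\in M$. Let $D=\sum_j e_j\partial_{x_j}$ be the Dirac operator. For $k\in\mathbb N_0$ let $M_l^+(k)$ be the right $\mathcal{C}\ell_m^{\mathbb R}$-module of left inner spherical monogenics of order $k$, i.e. of the homogeneous polynomials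 $P:\mathbb R^m\to\mathcal{C}\ell_m^{\mathbb R}$ of degree $k$ with $DP=0$, with the inner product $\frac{1}{|S^{m-1}|}\int_{S^{m-1}}P^\dagger Q\,dS$, and let $P_k^{(1)},\dots,P_k^{(d_k)}$ be an orthonormal basis of the right module $M_l^+(k)$. A polynomial $P$ on $\mathbb R^m$ is extended to $\mathbb C^m$ by inserting $z\in\mathbb C^m$; $\underline z=\sum_j z_je_j$. For $p,k\in\mathbb N_0$ put $$\gamma_{2p,k}=\frac{2^{2p+m/2+k}\,p!\,\sqrt{\pi}^{\,m}\,\Gamma(\frac m2+k+p)}{\Gamma(\frac m2)},\qquad \gamma_{2p+1,k}=\frac{2^{2p+m/2+k+1}\,p!\,\sqrt{\pi}^{\,m}\,\Gamma(\frac m2+k+p+1)}{\Gamma(\frac m2)}.$$ Let the Segal–Bargmann module $\mathcal F^2(\mathbb C^m,\mathcal{C}\ell_m^{\mathbb C})$ be the closure, in $L^2(\mathbb C^m,\pi^{-m}e^{-|z|^2}dx\,dy,\mathcal{C}\ell_m^{\mathbb C})$, of the right $\mathcal{C}\ell_m^{\mathbb C}$-module spanned by the functions $\underline z^{\,l}P(z)$,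 $l,k\in\mathbb N_0$, $P\in M_l^+(k)$. Let $$(\mathcal Bf)(z)=\frac{1}{(2\pi)^{m/2}}\int_{\mathbb R^m}e^{-\frac{z\cdot z}{2}+x\cdot z-\frac{x\cdot x}{4}}f(x)\,dx,\qquad x\cdot z=\sum_j x_jz_j,$$ be the Segal–Bargmann transform, and let $$\phi_{l,k,j}(x)=\frac{1}{\sqrt{\gamma_{l,k}}}\,e^{-\frac{|x|^2}{4}}\cdot(-1)^l e^{\frac{|x|^2}{2}}D^l\!\left(e^{-\frac{|x|^2}{2}}P_k^{(j)}(x)\right)$$ be the Clifford–Hermite functions. Then: (1) the functions $$\sqrt{\frac{(2\pi)^{m/2}}{\gamma_{l,k}}}\;\underline z^{\,l}P_k^{(j)}(z),\qquad l,k\in\mathbb N_0,\ 1\le j\le d_k,$$ form an orthonormal basis of the Segal–Bargmann module $\mathcal F^2(\mathbb C^m,\mathcal{C}\ell_m^{\mathbb C})$; (2) the functions $\phi_{l,k,j}$ are orthonormal in $L^2(\mathbb R^m,\mathcal{C}\ell_m^{\mathbb R})$, $(\mathcal B\phi_{l,k,j})(z)=\gamma_{l,k}^{-1/2}\,\underline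 z^{\,l}P_k^{(j)}(z)$ for all $z\in\mathbb C^m$, and the functions $(2\pi)^{m/4}\,\mathcal B\phi_{l,k,j}$ are the orthonormal basis in (1). -/

import Mathlib

open MeasureTheory

noncomputable section

namespace SegalBargmann

/-! ### The real and complex Clifford algebras -/

/-- The quadratic form `v ↦ - ∑ vⱼ ^ 2` on `𝕜 ^ m`. -/
def negSumSq (𝕜 : Type) [RCLike 𝕜] (m : ℕ) : QuadraticForm 𝕜 (Fin m → 𝕜) :=
  QuadraticMap.weightedSumSquares 𝕜 (fun _ : Fin m => (-1 : 𝕜))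

/-- The Clifford algebra over `𝕜 = ℝ` or `𝕜 = ℂ` with `m` generators that satisfy
`eᵢ eⱼ + eⱼ eᵢ = 0` for `i ≠ j` and `eⱼ ^ 2 = -1`. -/
def Cl (𝕜 : Type) [RCLike 𝕜] (m : ℕ) : Type := CliffordAlgebra (negSumSq 𝕜 m)

section Algebra

variable (𝕜 : Type) [RCLike 𝕜] (m : ℕ)

instance : Ring (Cl 𝕜 m) := inferInstanceAs (Ring (CliffordAlgebra (negSumSq 𝕜 m)))

instance : Algebra 𝕜 (Cl 𝕜 m) :=
  inferInstanceAs (Algebra 𝕜 (CliffordAlgebra (negSumSq 𝕜 m)))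

variable {m}

/-- The generator `eⱼ`. -/
def gen (j : Fin m) : Cl 𝕜 m := CliffordAlgebra.ι (negSumSq 𝕜 m) (Pi.single j 1)

/-- The blade `e_A = e_{n₁} ⋯ e_{nₗ}` for `A = {n₁ < ⋯ < nₗ}`. -/
def blade (A : Finset (Fin m)) : Cl 𝕜 m :=
  (List.ofFn fun i : Fin A.card => gen 𝕜 (A.orderEmbOfFin rfl i)).prod

variable (m)

/-- The basis of the Clifford algebra that corresponds to the standard basis of the exterior
algebra; its elements are the blades, see `bladeBasis_apply`. -/
def bladeBasis : Module.Basis (Finset (Fin m)) 𝕜 (Cl 𝕜 m) :=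
  letI : Invertible (2 : 𝕜) := invertibleOfNonzero two_ne_zero
  ((Pi.basisFun 𝕜 (Fin m)).ExteriorAlgebra).map
    (CliffordAlgebra.equivExterior (negSumSq 𝕜 m)).symm

theorem contractLeft_list_prod {R M I : Type*} [CommRing R] [AddCommGroup M] [Module R M]
    (Q : QuadraticForm R M) (v : I → M) (d : Module.Dual R M) (l : List I)
    (h : ∀ j ∈ l, d (v j) = 0) :
    CliffordAlgebra.contractLeft (Q := Q) d (l.map fun j => CliffordAlgebra.ι Q (v j)).prod = 0 := by
  induction l with
  | nil => simp
  | cons i l ih =>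
    rw [List.map_cons, List.prod_cons, CliffordAlgebra.contractLeft_ι_mul,
      ih fun j hj => h j (List.mem_cons_of_mem _ hj), h i List.mem_cons_self]
    simp

theorem changeForm_list_prod {R M I : Type*} [CommRing R] [AddCommGroup M] [Module R M]
    {Q Q' : QuadraticForm R M} {B : LinearMap.BilinForm R M}
    (h : B.toQuadraticMap = Q' - Q) (v : I → M) (hB : ∀ i j, i ≠ j → B (v i) (v j) = 0)
    (l : List I) (hl : l.Nodup) :
    CliffordAlgebra.changeForm h (l.map fun j => CliffordAlgebra.ι Q (v j)).prod =
      (l.map fun j => CliffordAlgebra.ι Q' (v j)).prod := by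
  induction l with
  | nil => simp
  | cons i l ih =>
    rw [List.nodup_cons] at hl
    rw [List.map_cons, List.prod_cons, CliffordAlgebra.changeForm_ι_mul, ih hl.2,
      contractLeft_list_prod, List.map_cons, List.prod_cons, sub_zero]
    intro j hj
    exact hB i j fun hij => hl.1 (hij ▸ hj)

theorem bladeBasis_apply (A : Finset (Fin m)) : bladeBasis 𝕜 m A = blade 𝕜 A := by
  let _ : Invertible (2 : 𝕜) := invertibleOfNonzero two_ne_zero
  change (CliffordAlgebra.equivExterior (negSumSq 𝕜 m)).symm
    ((Pi.basisFun 𝕜 (Fin m)).ExteriorAlgebra A) = _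
  refine (LinearEquiv.symm_apply_eq _).2 ?_
  have hnd : (List.ofFn fun i : Fin A.card => A.orderEmbOfFin rfl i).Nodup :=
    List.nodup_ofFn.2 (A.orderEmbOfFin rfl).injective
  have key := changeForm_list_prod
    (CliffordAlgebra.changeForm.associated_neg_proof (Q := negSumSq 𝕜 m))
    (fun j : Fin m => (Pi.single j 1 : Fin m → 𝕜)) (fun i j hij => ?_) _ hnd
  · rw [List.map_ofFn, List.map_ofFn] at key
    rw [ExteriorAlgebra.basis_apply]
    refine (ExteriorAlgebra.ιMulti_apply _).trans (Eq.trans ?_ key.symm)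
    congr 2
    funext i
    simp [Set.powersetCard.ofFinEmbEquiv_symm_apply]
  · have h0 : ∀ k : Fin m, (Pi.single i 1 : Fin m → 𝕜) k * (Pi.single j 1 : Fin m → 𝕜) k = 0 := by
      intro k
      by_cases hk : k = i
      · subst hk; simp [Pi.single_eq_of_ne hij]
      · simp [Pi.single_eq_of_ne hk]
    have h1 : QuadraticMap.polar (-negSumSq 𝕜 m) (Pi.single i 1) (Pi.single j 1) = 0 := by
      simp only [QuadraticMap.polar, negSumSq, neg_apply,
        QuadraticMap.weightedSumSquares_apply, Pi.add_apply, ← Finset.sum_neg_distrib,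
        ← Finset.sum_sub_distrib]
      refine Finset.sum_eq_zero fun k _ => ?_
      simp only [smul_eq_mul]
      linear_combination 2 * h0 k
    rw [QuadraticMap.associated_apply, ← QuadraticMap.polar, h1, smul_zero]

/-- The Hilbert space of coefficients `(a_A)_A`. -/
def coeffs : Cl 𝕜 m ≃ₗ[𝕜] EuclideanSpace 𝕜 (Finset (Fin m)) :=
  (bladeBasis 𝕜 m).equivFun ≪≫ₗ (WithLp.linearEquiv 2 𝕜 (Finset (Fin m) → 𝕜)).symm

/-- The norm `|a|₀ = (∑ |a_A| ^ 2) ^ (1 / 2)`. -/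
instance : NormedAddCommGroup (Cl 𝕜 m) :=
  NormedAddCommGroup.induced (Cl 𝕜 m) (EuclideanSpace 𝕜 (Finset (Fin m))) (coeffs 𝕜 m)
    (coeffs 𝕜 m).injective

instance : NormedSpace 𝕜 (Cl 𝕜 m) :=
  NormedSpace.induced 𝕜 (Cl 𝕜 m) (EuclideanSpace 𝕜 (Finset (Fin m))) (coeffs 𝕜 m)

instance : FiniteDimensional 𝕜 (Cl 𝕜 m) := (bladeBasis 𝕜 m).finiteDimensional_of_finite

variable {𝕜 m}

/-- The involution `a ↦ ∑ conj(a_A) (-1) ^ (|A| (|A| + 1) / 2) e_A`. For `𝕜 = ℝ` it is the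
conjugation of the real Clifford algebra, for `𝕜 = ℂ` the involution `†` of the complex one. -/
def dagger (a : Cl 𝕜 m) : Cl 𝕜 m :=
  ∑ A : Finset (Fin m),
    (starRingEnd 𝕜 ((bladeBasis 𝕜 m).repr a A) * (-1) ^ (A.card * (A.card + 1) / 2)) • blade 𝕜 A

/-- The Clifford vector `∑ vⱼ eⱼ`. -/
def vec (v : Fin m → 𝕜) : Cl 𝕜 m := ∑ j, v j • gen 𝕜 j

/-- The inclusion of the real into the complex Clifford algebra. -/
def complexify (a : Cl ℝ m) : Cl ℂ m :=
  ∑ A : Finset (Fin m), (((bladeBasis ℝ m).repr a A : ℝ) : ℂ) • blade ℂ A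

/-- Multiplication by `a` from the right. -/
def mulRightCLM (a : Cl 𝕜 m) : Cl 𝕜 m →L[𝕜] Cl 𝕜 m :=
  LinearMap.toContinuousLinearMap (LinearMap.mulRight 𝕜 a)

end Algebra

/-! ### Hilbert Clifford modules of square-integrable functions -/

section Modules

variable {𝕜 : Type} [RCLike 𝕜] {m : ℕ} {X : Type} [MeasurableSpace X]

/-- The Clifford algebra-valued inner product `⟨F, G⟩ = ∫ F† G dμ`. -/
def cliffordInner [NormedSpace ℝ (Cl 𝕜 m)] (μ : Measure X) (F G : X → Cl 𝕜 m) : Cl 𝕜 m :=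
  ∫ x, dagger (F x) * G x ∂μ

/-- The right module structure on `L²`: the function `x ↦ F x * a`. -/
def rightMul {μ : Measure X} (F : Lp (Cl 𝕜 m) 2 μ) (a : Cl 𝕜 m) : Lp (Cl 𝕜 m) 2 μ :=
  (mulRightCLM a).compLp F

/-- A family in `L²(X, μ, Cl)` is orthonormal if its Clifford algebra-valued Gram matrix is the
identity. -/
def IsOrthonormalFamily [NormedSpace ℝ (Cl 𝕜 m)] {I : Type} [DecidableEq I] {μ : Measure X}
    (Ψ : I → Lp (Cl 𝕜 m) 2 μ) : Prop :=
  ∀ i j, cliffordInner μ (Ψ i) (Ψ j) = if i = j then 1 else 0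

/-- An orthonormal basis of a submodule `M` of `L²(X, μ, Cl)`: an orthonormal family in `M` such
that every `F ∈ M` has the norm convergent expansion `F = ∑ᵢ Ψᵢ ⟨Ψᵢ, F⟩`. -/
structure IsOrthonormalBasis [NormedSpace ℝ (Cl 𝕜 m)] {I : Type} [DecidableEq I] {μ : Measure X}
    (M : Submodule 𝕜 (Lp (Cl 𝕜 m) 2 μ)) (Ψ : I → Lp (Cl 𝕜 m) 2 μ) : Prop where
  mem : ∀ i, Ψ i ∈ M
  orthonormal : IsOrthonormalFamily Ψ
  hasSum : ∀ F ∈ M, HasSum (fun i => rightMul (Ψ i) (cliffordInner μ (Ψ i) F)) F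

end Modules

/-! ### Inner spherical monogenics -/

section Monogenics

variable {m : ℕ}

/-- A Clifford polynomial `∑ P_A e_A` in `m` variables with real scalar polynomials `P_A`, that
is, an element of the tensor product of the scalar polynomials with the real Clifford algebra. -/
abbrev CliffordPoly (m : ℕ) : Type := Finset (Fin m) → MvPolynomial (Fin m) ℝ

/-- The function `x ↦ P(x)` on `ℝ ^ m`. -/
def CliffordPoly.evalReal (P : CliffordPoly m) (x : EuclideanSpace ℝ (Fin m)) : Cl ℝ m :=
  ∑ A, MvPolynomial.eval (fun j => x j) (P A) • blade ℝ A

/-- The function `z ↦ P(z)` on `ℂ ^ m`. -/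
def CliffordPoly.evalComplex (P : CliffordPoly m) (z : Fin m → ℂ) : Cl ℂ m :=
  ∑ A, MvPolynomial.aeval z (P A) • blade ℂ A

/-- The Dirac operator `D f = ∑ⱼ eⱼ ∂f / ∂xⱼ`. -/
def dirac (f : EuclideanSpace ℝ (Fin m) → Cl ℝ m) (x : EuclideanSpace ℝ (Fin m)) : Cl ℝ m :=
  ∑ j, gen ℝ j * lineDeriv ℝ f x (EuclideanSpace.single j 1)

/-- The left inner spherical monogenics of order `k`: the homogeneous Clifford polynomials of
degree `k` that are annihilated by the Dirac operator acting from the left. -/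
def monogenics (m k : ℕ) : Set (CliffordPoly m) :=
  {P | (∀ A, (P A).IsHomogeneous k) ∧ ∀ x, dirac P.evalReal x = 0}

/-- The normalized surface measure on the unit sphere of `ℝ ^ m`. -/
def sphereMeasure (m : ℕ) : Measure (Metric.sphere (0 : EuclideanSpace ℝ (Fin m)) 1) :=
  ((volume : Measure (EuclideanSpace ℝ (Fin m))).toSphere Set.univ)⁻¹ •
    (volume : Measure (EuclideanSpace ℝ (Fin m))).toSphere

/-- The Clifford algebra-valued inner product of Clifford polynomials: the mean value of
`conj(P) Q` over the unit sphere. -/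
def sphereInner (P Q : CliffordPoly m) : Cl ℝ m :=
  cliffordInner (sphereMeasure m) (fun x => P.evalReal x) (fun x => Q.evalReal x)

/-- A finite orthonormal basis of the right module of inner spherical monogenics of order `k`. -/
structure IsMonogenicBasis {d : ℕ} (k : ℕ) (P : Fin d → CliffordPoly m) : Prop where
  mem : ∀ j, P j ∈ monogenics m k
  orthonormal : ∀ i j, sphereInner (P i) (P j) = if i = j then 1 else 0
  span : ∀ Q ∈ monogenics m k, ∃ a : Fin d → Cl ℝ m,
    ∀ x, Q.evalReal x = ∑ j, (P j).evalReal x * a j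

end Monogenics

/-! ### Clifford-Hermite functions -/

section Hermite

variable {m : ℕ}

/-- The constants `γ_{l,k}`, with `l = 2 p` or `l = 2 p + 1`:
`γ_{2p,k} = 2 ^ (2p + m/2 + k) p! √π ^ m Γ(m/2 + k + p) / Γ(m/2)` and
`γ_{2p+1,k} = 2 ^ (2p + m/2 + k + 1) p! √π ^ m Γ(m/2 + k + p + 1) / Γ(m/2)`. -/
def hermiteGamma (m l k : ℕ) : ℝ :=
  let p : ℕ := l / 2
  if Even l then
    (2 : ℝ) ^ (2 * p + (m : ℝ) / 2 + k) * p.factorial * √Real.pi ^ m *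
      Real.Gamma ((m : ℝ) / 2 + k + p) / Real.Gamma ((m : ℝ) / 2)
  else
    (2 : ℝ) ^ (2 * p + (m : ℝ) / 2 + k + 1) * p.factorial * √Real.pi ^ m *
      Real.Gamma ((m : ℝ) / 2 + k + p + 1) / Real.Gamma ((m : ℝ) / 2)

/-- The function `H_{l,m,k} P = (-1) ^ l exp(|x|² / 2) D ^ l (exp(-|x|² / 2) P)`. -/
def hermitePoly (l : ℕ) (P : CliffordPoly m) (x : EuclideanSpace ℝ (Fin m)) : Cl ℝ m :=
  ((-1) ^ l * Real.exp (‖x‖ ^ 2 / 2)) •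
    (dirac^[l] fun y => Real.exp (-‖y‖ ^ 2 / 2) • P.evalReal y) x

/-- The Clifford-Hermite function `γ_{l,k} ^ (-1/2) H_{l,m,k}(x) P(x) exp(-|x|² / 4)`, for an inner
spherical monogenic `P` of order `k`. -/
def hermiteFunction (l k : ℕ) (P : CliffordPoly m) (x : EuclideanSpace ℝ (Fin m)) : Cl ℝ m :=
  ((√(hermiteGamma m l k))⁻¹ * Real.exp (-‖x‖ ^ 2 / 4)) • hermitePoly l P x

end Hermite

/-! ### The Segal-Bargmann transform and the Segal-Bargmann module -/

section Bargmann

variable {m : ℕ}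

/-- The Segal-Bargmann transform
`(B f)(z) = (2π) ^ (-m/2) ∫ exp(-z⬝z/2 + x⬝z - x⬝x/4) f(x) dx` with bilinear dot products. -/
def bargmann (f : EuclideanSpace ℝ (Fin m) → Cl ℝ m) (z : Fin m → ℂ) : Cl ℂ m :=
  (√(2 * Real.pi) ^ m)⁻¹ •
    ∫ x : EuclideanSpace ℝ (Fin m),
      Complex.exp (-(∑ j, z j * z j) / 2 + ∑ j, (x j : ℂ) * z j
        - (∑ j, (x j : ℂ) * (x j : ℂ)) / 4) • complexify (f x)

/-- The measure `π ^ (-m) exp(-|z|²) dx dy` on `ℂ ^ m`. -/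
def fockMeasure (m : ℕ) : Measure (Fin m → ℂ) :=
  volume.withDensity fun z =>
    ENNReal.ofReal (Real.exp (-∑ j, ‖z j‖ ^ 2) / Real.pi ^ m)

/-- The function `z ↦ z ^ l P(z)` on `ℂ ^ m`, where the power is that of the Clifford vector. -/
def vecPowMul (l : ℕ) (P : CliffordPoly m) (z : Fin m → ℂ) : Cl ℂ m :=
  vec z ^ l * P.evalComplex z

/-- The Segal-Bargmann module: the closure in `L²(ℂ ^ m, π ^ (-m) exp(-|z|²), Cl)` of the right
module generated by the functions `z ^ l P(z)`, where `l` and `k` are natural numbers and `P` is an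
inner spherical monogenic of order `k`. This right module is the complex linear span of the
functions `z ^ l P(z) a` with `a` in the complex Clifford algebra. -/
def segalBargmannModule (m : ℕ) : Submodule ℂ (Lp (Cl ℂ m) 2 (fockMeasure m)) :=
  (Submodule.span ℂ {F : Lp (Cl ℂ m) 2 (fockMeasure m) |
    ∃ (l k : ℕ) (P : CliffordPoly m) (a : Cl ℂ m), P ∈ monogenics m k ∧
      F =ᵐ[fockMeasure m] fun z => vecPowMul l P z * a}).topologicalClosure

end Bargmann

end SegalBargmann

end

open SegalBargmann

noncomputable section
namespace SegalBargmann

/-! ### Clifford algebra: generators, complexification, the involution and the scalar part -/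

section CliffordAlgebraLemmas

variable {𝕜 : Type} [RCLike 𝕜] {m : ℕ}

/-! Both orthonormality claims are one algebraic computation. Let operators T_j on scalar
polynomials commute with each other, satisfy [∂_i, T_j] = δ_ij, and be adjoint to ∂_j for a
symmetric form B. Put T = ∑ e_j T_j, D = ∑ e_j ∂_j and N = ∑ T_j ∂_j. The Clifford relations give DT
+ TD = -2N - m (`cliffOp_anticomm`). If Du = 0 and Nu = ku, then D T^(l+1) u = -c_(l+1) T^l u with
explicit constants (`cliffOp_dirac_pow`). Since e_j† = -e_j, the operators T and -D are adjoint for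
the Clifford-valued pairing, so ⟨T^l u, T^l' v⟩ vanishes for l ≠ l' and equals c_1 ⋯ c_l ⟨u, v⟩ for
l = l' (`pairing_pow`). The constants γ_{l,k} obey the same recursion in l (`hermiteGamma_succ`).

The computation is used twice: for T_j = x_j with the Fischer form, which is the Fock inner product,
and for T_j = x_j - ∂_j with the Gaussian form. In the second case T^l P is the Clifford-Hermite
polynomial, because T is -D conjugated by exp(-|x|²/2). Since D² = -Δ, the components of a monogenic
are harmonic. On harmonic polynomials both number operators are the Euler operator, and induction on
the degree shows that the two forms coincide (`IsHarmonic.form_eq`). Polar coordinates relate the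
Gaussian form to the sphere inner product, with constant γ_{0,k}
(`pairing_gaussForm_eq_sphereInner`).

For the transform, integration by parts turns x_j - ∂_j into multiplication by z_j
(`gaussFunctional_gaussOp`), and the same degree induction sends a harmonic p to p(z)
(`IsHarmonic.functional_eq`).

Completeness is built into the definition of the module as a closure. The scalar part of ⟨F, G⟩ is
an ordinary Hilbert space inner product, for which the functions Ψ_i e_A are orthonormal. Their
Fourier expansion, regrouped over A, is the Clifford expansion (`isOrthonormalBasis_closure_span`).
-/

theorem gen_mul_gen_add (i j : Fin m) :
    gen 𝕜 i * gen 𝕜 j + gen 𝕜 j * gen 𝕜 i = if i = j then -2 else 0 := by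
  have h := CliffordAlgebra.ι_mul_ι_add_swap (Q := negSumSq 𝕜 m) (Pi.single i 1) (Pi.single j 1)
  refine Eq.trans h ?_
  have h0 : QuadraticMap.polar (negSumSq 𝕜 m) (Pi.single i 1) (Pi.single j 1) =
      if i = j then -2 else 0 := by
    simp only [QuadraticMap.polar, negSumSq, QuadraticMap.weightedSumSquares_apply, Pi.add_apply,
      ← Finset.sum_sub_distrib, smul_eq_mul]
    rw [Finset.sum_congr rfl (g := fun k => -2 * ((Pi.single i 1 : Fin m → 𝕜) k *
      (Pi.single j 1 : Fin m → 𝕜) k)) (fun k _ => by ring)]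
    simp [Pi.single_apply, eq_comm]
  rw [h0]
  split_ifs
  · exact (algebraMap 𝕜 (CliffordAlgebra (negSumSq 𝕜 m))).map_neg 2 |>.trans (by
      rw [map_ofNat]; rfl)
  · exact map_zero _

theorem gen_mul_self (j : Fin m) : gen 𝕜 j * gen 𝕜 j = -1 := by
  have h := gen_mul_gen_add (𝕜 := 𝕜) j j
  rw [if_pos rfl, ← two_smul 𝕜, show (-2 : Cl 𝕜 m) = (2 : 𝕜) • (-1 : Cl 𝕜 m) by
    rw [smul_neg, two_smul]; norm_num] at h
  exact smul_right_injective _ two_ne_zero h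

theorem gen_mul_gen_of_ne {i j : Fin m} (h : i ≠ j) :
    gen 𝕜 i * gen 𝕜 j = -(gen 𝕜 j * gen 𝕜 i) := by
  have := gen_mul_gen_add (𝕜 := 𝕜) i j
  rw [if_neg h] at this
  exact eq_neg_of_add_eq_zero_left this

/-- The algebra homomorphism out of the Clifford algebra with prescribed images of the
generators. -/
def genLift {A : Type} [Ring A] [Algebra 𝕜 A] (g : Fin m → A)
    (hg : ∀ i j, g i * g j + g j * g i = if i = j then -2 else 0) : Cl 𝕜 m →ₐ[𝕜] A :=
  CliffordAlgebra.lift (negSumSq 𝕜 m) ⟨Fintype.linearCombination 𝕜 g, fun v => by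
    -- Only anticommutators are known, so the square is doubled and one copy is written with the
    -- factors swapped.
    have h2 : (2 : 𝕜) • (Fintype.linearCombination 𝕜 g v * Fintype.linearCombination 𝕜 g v) =
        (2 : 𝕜) • algebraMap 𝕜 A (negSumSq 𝕜 m v) := by
      have h3 : Fintype.linearCombination 𝕜 g v * Fintype.linearCombination 𝕜 g v =
          ∑ i, ∑ j, (v i * v j) • (g i * g j) := by
        simp only [Fintype.linearCombination_apply, Finset.sum_mul_sum, smul_mul_smul_comm]
      have h4 : Fintype.linearCombination 𝕜 g v * Fintype.linearCombination 𝕜 g v =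
          ∑ i, ∑ j, (v i * v j) • (g j * g i) := by
        rw [h3, Finset.sum_comm]
        simp only [mul_comm]
      rw [two_smul]
      nth_rewrite 1 [h3]
      rw [h4]
      simp only [← Finset.sum_add_distrib, ← smul_add, hg]
      simp only [smul_ite, smul_zero, Finset.sum_ite_eq, Finset.mem_univ, if_true]
      rw [← Finset.sum_smul, negSumSq, QuadraticMap.weightedSumSquares_apply,
        Algebra.algebraMap_eq_smul_one, smul_smul, Finset.mul_sum,
        show (-2 : A) = (-2 : 𝕜) • (1 : A) by
          rw [neg_smul, two_smul, one_add_one_eq_two], smul_smul, Finset.sum_mul]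
      congr 1
      refine Finset.sum_congr rfl fun i _ => ?_
      simp only [smul_eq_mul]
      ring
    exact smul_right_injective _ two_ne_zero h2⟩

theorem genLift_gen {A : Type} [Ring A] [Algebra 𝕜 A] (g : Fin m → A)
    (hg : ∀ i j, g i * g j + g j * g i = if i = j then -2 else 0) (j : Fin m) :
    genLift (𝕜 := 𝕜) g hg (gen 𝕜 j) = g j := by
  refine (CliffordAlgebra.lift_ι_apply (Q := negSumSq 𝕜 m) _ _ _).trans ?_
  simp [Fintype.linearCombination_apply, Pi.single_apply]

theorem map_blade {A F : Type} [Monoid A] [FunLike F (Cl 𝕜 m) A] [MonoidHomClass F (Cl 𝕜 m) A]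
    (f : F) (s : Finset (Fin m)) :
    f (blade 𝕜 s) = (List.ofFn fun i : Fin s.card => f (gen 𝕜 (s.orderEmbOfFin rfl i))).prod := by
  rw [blade, map_list_prod, List.map_ofFn]
  rfl

theorem sum_repr_smul_blade (a : Cl 𝕜 m) : ∑ A, (bladeBasis 𝕜 m).repr a A • blade 𝕜 A = a := by
  conv_rhs => rw [← (bladeBasis 𝕜 m).sum_repr a]
  simp only [bladeBasis_apply]

theorem repr_blade (A : Finset (Fin m)) :
    (bladeBasis 𝕜 m).repr (blade 𝕜 A) = Finsupp.single A 1 := by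
  rw [← bladeBasis_apply, Module.Basis.repr_self]

theorem blade_induction {p : Cl 𝕜 m → Prop} (hb : ∀ A, p (blade 𝕜 A))
    (ha : ∀ a b, p a → p b → p (a + b)) (hs : ∀ (c : 𝕜) a, p a → p (c • a)) (a : Cl 𝕜 m) :
    p a := by
  rw [← sum_repr_smul_blade a]
  refine Finset.sum_induction _ p ha ?_ fun A _ => hs _ _ (hb A)
  simpa using hs 0 _ (hb ∅)

theorem blade_empty : blade 𝕜 (∅ : Finset (Fin m)) = 1 := by
  simp [blade]

/-! ### Complexification as an algebra homomorphism -/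

/-- The inclusion of the real into the complex Clifford algebra as an algebra homomorphism. -/
def complexifyHom (m : ℕ) : Cl ℝ m →ₐ[ℝ] Cl ℂ m := genLift (fun j => gen ℂ j) gen_mul_gen_add

theorem complexifyHom_gen (j : Fin m) : complexifyHom m (gen ℝ j) = gen ℂ j := genLift_gen _ _ _

theorem complexifyHom_blade (A : Finset (Fin m)) : complexifyHom m (blade ℝ A) = blade ℂ A := by
  rw [map_blade]
  simp only [complexifyHom_gen, blade]

/-- Blades go to blades on both sides. This makes the coefficientwise inclusion multiplicative. -/
theorem complexify_eq (a : Cl ℝ m) : complexify a = complexifyHom m a := by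
  conv_rhs => rw [← sum_repr_smul_blade a]
  rw [map_sum]
  refine Finset.sum_congr rfl fun A _ => ?_
  rw [map_smul, complexifyHom_blade, Complex.coe_smul]

theorem repr_complexifyHom (a : Cl ℝ m) (A : Finset (Fin m)) :
    (bladeBasis ℂ m).repr (complexifyHom m a) A = (((bladeBasis ℝ m).repr a A : ℝ) : ℂ) := by
  rw [← complexify_eq, complexify, map_sum, Finsupp.finsetSum_apply]
  simp only [map_smul, Finsupp.smul_apply, repr_blade, Finsupp.single_apply, smul_eq_mul, mul_ite,
    mul_one, mul_zero, Finset.sum_ite_eq', Finset.mem_univ, if_true]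

/-! ### The involution -/

theorem repr_dagger (a : Cl 𝕜 m) (A : Finset (Fin m)) : (bladeBasis 𝕜 m).repr (dagger a) A =
    starRingEnd 𝕜 ((bladeBasis 𝕜 m).repr a A) * (-1) ^ (A.card * (A.card + 1) / 2) := by
  rw [dagger, map_sum, Finsupp.finsetSum_apply]
  simp [repr_blade, Finsupp.single_apply]

theorem dagger_add (a b : Cl 𝕜 m) : dagger (a + b) = dagger a + dagger b := by
  simp [dagger, add_mul, add_smul, Finset.sum_add_distrib]

theorem dagger_smul (c : 𝕜) (a : Cl 𝕜 m) : dagger (c • a) = starRingEnd 𝕜 c • dagger a := by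
  simp [dagger, Finset.smul_sum, smul_smul, mul_assoc]

/-- The involution as a conjugate-linear map. -/
def daggerₗ (𝕜 : Type) [RCLike 𝕜] (m : ℕ) : Cl 𝕜 m →ₛₗ[starRingEnd 𝕜] Cl 𝕜 m where
  toFun := dagger
  map_add' := dagger_add
  map_smul' := dagger_smul

theorem daggerₗ_apply (a : Cl 𝕜 m) : daggerₗ 𝕜 m a = dagger a := rfl

theorem dagger_blade (A : Finset (Fin m)) :
    dagger (blade 𝕜 A) = (-1 : 𝕜) ^ (A.card * (A.card + 1) / 2) • blade 𝕜 A := by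
  rw [dagger, Finset.sum_eq_single A]
  · simp [repr_blade]
  · intro B _ hB
    simp [repr_blade, hB.symm]
  · simp

theorem dagger_complexifyHom (a : Cl ℝ m) :
    dagger (complexifyHom m a) = complexifyHom m (dagger a) := by
  refine (bladeBasis ℂ m).repr.injective (Finsupp.ext fun A => ?_)
  rw [repr_dagger, repr_complexifyHom, repr_complexifyHom, repr_dagger]
  simp

theorem list_prod_mul_of_anticomm {R : Type*} [Ring R] (a : R) (l : List R)
    (h : ∀ b ∈ l, b * a = -(a * b)) : l.prod * a = (-1) ^ l.length * (a * l.prod) := by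
  induction l with
  | nil => simp
  | cons b l ih =>
    have ih := ih fun c hc => h c (List.mem_cons_of_mem _ hc)
    have hb := h b List.mem_cons_self
    have hc : Commute b ((-1) ^ l.length) := (Commute.neg_one_right b).pow_right _
    rw [List.prod_cons, mul_assoc, ih, ← mul_assoc, hc.eq, mul_assoc, ← mul_assoc b, hb,
      List.length_cons, pow_succ]
    simp [mul_assoc]

/-- Reversing n anticommuting factors costs n(n-1)/2 signs and negating them costs n more, in total
n(n+1)/2, the exponent in `dagger`. -/
theorem reverse_map_neg_prod {R : Type*} [Ring R] (l : List R)
    (h : l.Pairwise fun a b => b * a = -(a * b)) :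
    (l.map Neg.neg).reverse.prod = (-1) ^ (l.length * (l.length + 1) / 2) * l.prod := by
  induction l with
  | nil => simp
  | cons a l ih =>
    rw [List.pairwise_cons] at h
    rw [List.map_cons, List.reverse_cons, List.prod_append, ih h.2, List.prod_singleton, mul_assoc,
      mul_neg, list_prod_mul_of_anticomm a l h.1, List.length_cons, List.prod_cons,
      show (l.length + 1) * (l.length + 1 + 1) / 2 =
        l.length * (l.length + 1) / 2 + l.length + 1 by
        have := Nat.triangle_succ (l.length + 1)
        simp only [Nat.add_sub_cancel] at this
        rw [mul_comm (l.length + 1) l.length] at this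
        rw [mul_comm (l.length + 1)]; lia]
    rw [pow_succ, pow_add]
    simp [mul_assoc]

/-- The conjugation of the Clifford algebra as the composition of reversion and the main
involution. -/
def conjugation (a : Cl ℝ m) : Cl ℝ m :=
  CliffordAlgebra.reverse (Q := negSumSq ℝ m) (CliffordAlgebra.involute (Q := negSumSq ℝ m) a)

theorem conjugation_mul (a b : Cl ℝ m) : conjugation (a * b) = conjugation b * conjugation a := by
  unfold conjugation
  exact (congrArg _ (map_mul (CliffordAlgebra.involute (Q := negSumSq ℝ m)) a b)).trans
    (CliffordAlgebra.reverse.map_mul (Q := negSumSq ℝ m) _ _)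

theorem conjugation_gen (j : Fin m) : conjugation (gen ℝ j) = -gen ℝ j := by
  unfold conjugation gen
  exact (congrArg _ (CliffordAlgebra.involute_ι (Q := negSumSq ℝ m) _)).trans
    ((map_neg _ _).trans (congrArg _ (CliffordAlgebra.reverse_ι (Q := negSumSq ℝ m) _)))

theorem conjugation_one : conjugation (1 : Cl ℝ m) = 1 := by
  unfold conjugation
  exact (congrArg _ (map_one (CliffordAlgebra.involute (Q := negSumSq ℝ m)))).trans
    (CliffordAlgebra.reverse.map_one (Q := negSumSq ℝ m))

theorem conjugation_list_prod (l : List (Cl ℝ m)) :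
    conjugation l.prod = (l.map conjugation).reverse.prod := by
  induction l with
  | nil => simp [conjugation_one]
  | cons a l ih => simp [conjugation_mul, ih]

theorem conjugation_blade (A : Finset (Fin m)) :
    conjugation (blade ℝ A) = (-1 : ℝ) ^ (A.card * (A.card + 1) / 2) • blade ℝ A := by
  have h := reverse_map_neg_prod
    (List.ofFn fun i : Fin A.card => gen ℝ (A.orderEmbOfFin rfl i)) ?_
  · rw [blade, conjugation_list_prod]
    rw [List.length_ofFn] at h
    rw [show ((-1 : ℝ) ^ (A.card * (A.card + 1) / 2)) •
      (List.ofFn fun i : Fin A.card => gen ℝ (A.orderEmbOfFin rfl i)).prod =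
      (-1) ^ (A.card * (A.card + 1) / 2) *
      (List.ofFn fun i : Fin A.card => gen ℝ (A.orderEmbOfFin rfl i)).prod by
        rw [Algebra.smul_def]; simp, ← h, List.map_ofFn, List.map_ofFn]
    congr 3
    funext i
    exact conjugation_gen _
  · rw [List.pairwise_ofFn]
    intro i j hij
    exact gen_mul_gen_of_ne fun h => hij.ne' ((A.orderEmbOfFin rfl).injective h)

/-- Both maps are real linear and carry the same sign on each blade. The right side is visibly an
antihomomorphism, which the coefficient formula for `dagger` hides. -/
theorem dagger_eq_conjugation (a : Cl ℝ m) : dagger a = conjugation a := by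
  refine blade_induction (p := fun a => dagger a = conjugation a) (fun A => ?_)
    (fun a b ha hb => ?_)
    (fun c a ha => ?_) a
  · rw [dagger_blade, conjugation_blade]
  · rw [dagger_add, ha, hb]
    unfold conjugation
    exact ((congrArg _ (map_add (CliffordAlgebra.involute (Q := negSumSq ℝ m)) a b)).trans
      (map_add _ _ _)).symm
  · rw [dagger_smul, ha]
    unfold conjugation
    exact ((congrArg _ (map_smul (CliffordAlgebra.involute (Q := negSumSq ℝ m)) c a)).trans
      (map_smul _ _ _)).symm

theorem dagger_mul_real (a b : Cl ℝ m) : dagger (a * b) = dagger b * dagger a := by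
  simp only [dagger_eq_conjugation, conjugation_mul]

/-- Conjugate linearity reduces the claim to blades, which come from the real algebra, where it is
known. -/
theorem dagger_mul (a b : Cl ℂ m) : dagger (a * b) = dagger b * dagger a := by
  refine blade_induction (p := fun a => dagger (a * b) = dagger b * dagger a) (fun A => ?_)
    (fun a a' ha ha' => ?_) (fun c a ha => ?_) a
  · refine blade_induction (p := fun b => dagger (blade ℂ A * b) = dagger b * dagger (blade ℂ A))
      (fun B => ?_) (fun a a' ha ha' => ?_) (fun c a ha => ?_) b
    · simp only [← complexifyHom_blade, ← map_mul, dagger_complexifyHom, dagger_mul_real]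
    · rw [mul_add, dagger_add, dagger_add, ha, ha', add_mul]
    · rw [mul_smul_comm, dagger_smul, dagger_smul, ha, smul_mul_assoc]
  · rw [add_mul, dagger_add, dagger_add, ha, ha', mul_add]
  · rw [smul_mul_assoc, dagger_smul, dagger_smul, ha, mul_smul_comm]

theorem dagger_gen_real (j : Fin m) : dagger (gen ℝ j) = -gen ℝ j := by
  rw [dagger_eq_conjugation, conjugation_gen]

theorem dagger_real_smul (c : ℝ) (a : Cl ℂ m) : dagger (c • a) = c • dagger a := by
  rw [← Complex.coe_smul, dagger_smul, Complex.conj_ofReal, Complex.coe_smul]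

theorem list_prod_reverse_map_neg_mul {R : Type*} [Ring R] (l : List R) (h : ∀ a ∈ l, a * a = -1) :
    (l.map Neg.neg).reverse.prod * l.prod = 1 := by
  induction l with
  | nil => simp
  | cons a l ih =>
    have ha := h a List.mem_cons_self
    rw [List.map_cons, List.reverse_cons, List.prod_append, List.prod_singleton, List.prod_cons,
      mul_assoc, ← mul_assoc (-a), neg_mul, ha, neg_neg, one_mul,
      ih fun b hb => h b (List.mem_cons_of_mem _ hb)]

theorem dagger_blade_mul_self_real (A : Finset (Fin m)) :
    dagger (blade ℝ A) * blade ℝ A = 1 := by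
  rw [dagger_eq_conjugation, blade, conjugation_list_prod]
  have h : (List.ofFn fun i : Fin A.card => gen ℝ (A.orderEmbOfFin rfl i)).map conjugation =
      (List.ofFn fun i : Fin A.card => gen ℝ (A.orderEmbOfFin rfl i)).map Neg.neg := by
    rw [List.map_ofFn, List.map_ofFn]
    congr 1
    funext i
    exact conjugation_gen _
  rw [h]
  refine list_prod_reverse_map_neg_mul _ fun a ha => ?_
  obtain ⟨i, rfl⟩ := (List.mem_ofFn' _ _).1 ha
  exact gen_mul_self _

/-! ### The scalar part -/

/-- The reflection automorphism that changes the sign of the generator `eⱼ`. -/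
def signFlip (j : Fin m) : Cl ℝ m →ₐ[ℝ] Cl ℝ m :=
  genLift (fun i => if i = j then -gen ℝ i else gen ℝ i) fun i i' => by
    rw [← gen_mul_gen_add (𝕜 := ℝ) i i']
    by_cases hii : i = i'
    · subst hii; split_ifs <;> simp
    · have h := gen_mul_gen_of_ne (𝕜 := ℝ) hii
      split_ifs <;> simp [h]

theorem signFlip_blade (j : Fin m) (A : Finset (Fin m)) :
    signFlip j (blade ℝ A) = (if j ∈ A then -1 else 1 : ℝ) • blade ℝ A := by
  rw [map_blade]
  have h : ∀ i : Fin A.card, signFlip j (gen ℝ (A.orderEmbOfFin rfl i)) =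
      (if A.orderEmbOfFin rfl i = j then (-1 : ℝ) else 1) • gen ℝ (A.orderEmbOfFin rfl i) := by
    intro i
    rw [signFlip, genLift_gen]
    split_ifs <;> simp
  have key : ∀ (l : List (Fin m)) (_ : l.Nodup),
      (l.map fun i => (if i = j then (-1 : ℝ) else 1) • gen ℝ i).prod =
      (if j ∈ l then (-1 : ℝ) else 1) • (l.map fun i => gen ℝ i).prod := by
    intro l hl
    induction l with
    | nil => simp
    | cons i l ih =>
      rw [List.nodup_cons] at hl
      rw [List.map_cons, List.prod_cons, ih hl.2, List.map_cons, List.prod_cons,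
        smul_mul_smul_comm]
      congr 1
      by_cases hij : i = j
      · subst hij; simp [hl.1]
      · simp [hij, Ne.symm hij]
  have hl := key (List.ofFn fun i : Fin A.card => A.orderEmbOfFin rfl i)
    (List.nodup_ofFn.2 (A.orderEmbOfFin rfl).injective)
  rw [List.map_ofFn, List.map_ofFn] at hl
  simp only [h]
  refine hl.trans ?_
  congr 1
  congr 1
  rw [List.mem_ofFn', Finset.range_orderEmbOfFin]
  simp

/-- The coefficient of the unit. -/
def scalarPart (𝕜 : Type) [RCLike 𝕜] (m : ℕ) : Cl 𝕜 m →ₗ[𝕜] 𝕜 :=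
  (bladeBasis 𝕜 m).coord ∅

theorem scalarPart_blade (A : Finset (Fin m)) :
    scalarPart 𝕜 m (blade 𝕜 A) = if A = ∅ then 1 else 0 := by
  rw [scalarPart, Module.Basis.coord_apply, repr_blade, Finsupp.single_apply]

theorem scalarPart_signFlip (j : Fin m) (a : Cl ℝ m) :
    scalarPart ℝ m (signFlip j a) = scalarPart ℝ m a := by
  refine blade_induction (p := fun a => scalarPart ℝ m (signFlip j a) = scalarPart ℝ m a)
    (fun A => ?_) (fun a a' ha ha' => ?_) (fun c a ha => ?_) a
  · rw [signFlip_blade, map_smul, scalarPart_blade]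
    by_cases hA : A = ∅ <;> simp [hA]
  · rw [map_add, map_add, map_add, ha, ha']
  · rw [map_smul, map_smul, map_smul, ha]

/-- A symmetry argument avoids multiplying out blades: for A ≠ B some generator occurs in exactly
one of them, so its sign flip negates the product, yet it preserves scalar parts. -/
theorem scalarPart_dagger_blade_mul_blade_real (A B : Finset (Fin m)) :
    scalarPart ℝ m (dagger (blade ℝ A) * blade ℝ B) = if A = B then 1 else 0 := by
  by_cases hAB : A = B
  · subst hAB
    rw [if_pos rfl, dagger_blade_mul_self_real, ← blade_empty, scalarPart_blade, if_pos rfl]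
  rw [if_neg hAB]
  obtain ⟨j, hj⟩ : ∃ j, ¬(j ∈ A ↔ j ∈ B) := by
    by_contra! h
    exact hAB (Finset.ext h)
  have h := scalarPart_signFlip j (blade ℝ A * blade ℝ B)
  rw [map_mul, signFlip_blade, signFlip_blade, smul_mul_smul_comm, map_smul] at h
  rw [dagger_blade, smul_mul_assoc, map_smul]
  have h2 : scalarPart ℝ m (blade ℝ A * blade ℝ B) = 0 := by
    by_cases hA : j ∈ A <;> by_cases hB : j ∈ B <;> simp [hA, hB] at hj h <;> linarith
  rw [h2, smul_zero]

theorem scalarPart_complexifyHom (a : Cl ℝ m) :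
    scalarPart ℂ m (complexifyHom m a) = ((scalarPart ℝ m a : ℝ) : ℂ) :=
  repr_complexifyHom a ∅

theorem scalarPart_dagger_blade_mul_blade (A B : Finset (Fin m)) :
    scalarPart ℂ m (dagger (blade ℂ A) * blade ℂ B) = if A = B then 1 else 0 := by
  rw [← complexifyHom_blade, ← complexifyHom_blade, dagger_complexifyHom, ← map_mul,
    scalarPart_complexifyHom, scalarPart_dagger_blade_mul_blade_real]
  split_ifs <;> simp

theorem scalarPart_dagger_blade_mul (A : Finset (Fin m)) (b : Cl ℂ m) :
    scalarPart ℂ m (dagger (blade ℂ A) * b) = (bladeBasis ℂ m).repr b A := by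
  conv_lhs => rw [← sum_repr_smul_blade b]
  simp [Finset.mul_sum, scalarPart_dagger_blade_mul_blade]

/-- This identifies the scalar part of a†b with the Hermitian inner product of coefficients, whose
norm is |·|₀. -/
theorem scalarPart_dagger_mul (a b : Cl ℂ m) :
    scalarPart ℂ m (dagger a * b) =
      ∑ A, starRingEnd ℂ ((bladeBasis ℂ m).repr a A) * (bladeBasis ℂ m).repr b A := by
  conv_lhs => rw [← sum_repr_smul_blade a]
  rw [← daggerₗ_apply, map_sum, Finset.sum_mul, map_sum]
  refine Finset.sum_congr rfl fun A _ => ?_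
  rw [daggerₗ_apply, dagger_smul, smul_mul_assoc, map_smul, scalarPart_dagger_blade_mul,
    smul_eq_mul]

theorem norm_sq_eq (a : Cl 𝕜 m) : ‖a‖ ^ 2 = ∑ A, ‖(bladeBasis 𝕜 m).repr a A‖ ^ 2 :=
  EuclideanSpace.norm_sq_eq (coeffs 𝕜 m a)

end CliffordAlgebraLemmas

/-! ### Clifford polynomials as tensors: raising operators, pairings, harmonic polynomials -/

section TensorPolynomials

open scoped TensorProduct

variable {m : ℕ}

/-- Scalar polynomials. -/
abbrev ScalarPoly (m : ℕ) : Type := MvPolynomial (Fin m) ℝ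

/-- Clifford polynomials as a tensor product. -/
abbrev TensorPoly (m : ℕ) : Type := ScalarPoly m ⊗[ℝ] Cl ℝ m

/-- Operators on scalar polynomials. -/
abbrev ScalarOp (m : ℕ) : Type := Module.End ℝ (ScalarPoly m)

/-- The action of a scalar operator on Clifford polynomials. -/
def scalarOp (L : ScalarOp m) : Module.End ℝ (TensorPoly m) :=
  TensorProduct.map L (LinearMap.id : Cl ℝ m →ₗ[ℝ] Cl ℝ m)

/-- The operator `∑ eⱼ Lⱼ`. -/
def cliffOp (L : Fin m → ScalarOp m) : Module.End ℝ (TensorPoly m) :=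
  ∑ j, TensorProduct.map (L j) (LinearMap.mulLeft ℝ (gen ℝ j))

/-- The partial derivative as a linear map. -/
def partialOp (j : Fin m) : ScalarOp m := (MvPolynomial.pderiv j).toLinearMap

/-- Multiplication by a variable. -/
def varOp (j : Fin m) : ScalarOp m := LinearMap.mulLeft ℝ (MvPolynomial.X j)

/-- The operator `xⱼ - ∂ⱼ`, the adjoint of `∂ⱼ` for the Gaussian weight. -/
def gaussOp (j : Fin m) : ScalarOp m := varOp j - partialOp j

@[simp] theorem scalarOp_tmul (L : ScalarOp m) (p : ScalarPoly m) (a : Cl ℝ m) :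
    scalarOp L (p ⊗ₜ a) = L p ⊗ₜ a := rfl

@[simp] theorem cliffOp_tmul (L : Fin m → ScalarOp m) (p : ScalarPoly m) (a : Cl ℝ m) :
    cliffOp L (p ⊗ₜ a) = ∑ j, L j p ⊗ₜ (gen ℝ j * a) := by
  simp [cliffOp, LinearMap.sum_apply]

@[simp] theorem partialOp_apply (j : Fin m) (p : ScalarPoly m) :
    partialOp j p = MvPolynomial.pderiv j p := rfl

@[simp] theorem varOp_apply (j : Fin m) (p : ScalarPoly m) :
    varOp j p = MvPolynomial.X j * p := rfl

@[simp] theorem gaussOp_apply (j : Fin m) (p : ScalarPoly m) :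
    gaussOp j p = MvPolynomial.X j * p - MvPolynomial.pderiv j p := rfl

/-- The commutator of two derivations is a derivation, and this one kills every variable. -/
theorem pderiv_comm (i j : Fin m) (p : ScalarPoly m) :
    MvPolynomial.pderiv i (MvPolynomial.pderiv j p) =
    MvPolynomial.pderiv j (MvPolynomial.pderiv i p) := by
  have h : ⁅(MvPolynomial.pderiv i : Derivation ℝ (ScalarPoly m) (ScalarPoly m)),
      (MvPolynomial.pderiv j : Derivation ℝ (ScalarPoly m) (ScalarPoly m))⁆ = 0 := by
    refine MvPolynomial.derivation_ext fun k => ?_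
    simp [Derivation.commutator_apply, MvPolynomial.pderiv_X, Pi.single_apply, apply_ite]
  have := DFunLike.congr_fun h p
  rwa [Derivation.commutator_apply, Derivation.zero_apply, sub_eq_zero] at this

/-- Operators that satisfy the canonical commutation relations with the partial derivatives. -/
structure IsRaising (T : Fin m → ScalarOp m) : Prop where
  comm : ∀ i j, T i * T j = T j * T i
  partial_mul : ∀ i j, partialOp i * T j = T j * partialOp i + if i = j then 1 else 0

theorem isRaising_varOp : IsRaising (varOp : Fin m → ScalarOp m) where
  comm i j := by
    refine LinearMap.ext fun p => ?_
    simp [mul_left_comm]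
  partial_mul i j := by
    refine LinearMap.ext fun p => ?_
    by_cases h : i = j
    · subst h; simp [mul_comm, add_comm]
    · simp [MvPolynomial.pderiv_X, h, Ne.symm h, mul_comm]

/-- In the commutator of x_i - ∂_i and x_j - ∂_j the two mixed terms contribute δ_ij with opposite
signs. Subtracting ∂_j does not change the commutator with ∂_i. -/
theorem isRaising_gaussOp : IsRaising (gaussOp : Fin m → ScalarOp m) where
  comm i j := by
    have h1 := isRaising_varOp.comm i j
    have h2 := isRaising_varOp.partial_mul i j
    have h3 := isRaising_varOp.partial_mul j i
    have h4 : partialOp i * partialOp j = partialOp j * partialOp i :=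
      LinearMap.ext fun p => pderiv_comm i j p
    simp only [gaussOp, mul_sub, sub_mul, h1, h2, h3, h4, eq_comm (a := j) (b := i)]
    abel
  partial_mul i j := by
    have h2 := isRaising_varOp.partial_mul i j
    have h4 : partialOp i * partialOp j = partialOp j * partialOp i :=
      LinearMap.ext fun p => pderiv_comm i j p
    simp only [gaussOp, mul_sub, sub_mul, h2, h4]
    abel

/-- The number operator `∑ Tⱼ ∂ⱼ`. -/
def numberOp (T : Fin m → ScalarOp m) : ScalarOp m := ∑ j, T j * partialOp j

/-- Symmetrizing in the generators leaves only the diagonal, since e_i e_j + e_j e_i = -2δ_ij. -/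
theorem sum_tmul_gen_mul_gen (p : Fin m → Fin m → ScalarPoly m) (a : Cl ℝ m) :
    ∑ i, ∑ j, p i j ⊗ₜ[ℝ] (gen ℝ i * (gen ℝ j * a)) +
        ∑ i, ∑ j, p i j ⊗ₜ[ℝ] (gen ℝ j * (gen ℝ i * a)) =
      -((2 : ℝ) • (∑ i, p i i) ⊗ₜ[ℝ] a) := by
  simp only [← Finset.sum_add_distrib, ← TensorProduct.tmul_add, ← mul_assoc, ← add_mul,
    gen_mul_gen_add, ite_mul, zero_mul, TensorProduct.tmul_ite,
    Finset.sum_ite_eq, Finset.mem_univ, if_true]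
  rw [TensorProduct.sum_tmul, Finset.smul_sum, ← Finset.sum_neg_distrib]
  refine Finset.sum_congr rfl fun i _ => ?_
  rw [← TensorProduct.tmul_smul, ← TensorProduct.tmul_neg, two_smul, neg_mul, two_mul]

/-- Moving ∂_i past T_j leaves δ_ij, which contributes ∑ e_j² = -m. The remaining terms T_j ∂_i
occur with both orders of the generators, and the Clifford relation collapses them to -2N. -/
theorem cliffOp_anticomm {T : Fin m → ScalarOp m} (hT : IsRaising T) (u : TensorPoly m) :
    cliffOp partialOp (cliffOp T u) =
      -cliffOp T (cliffOp partialOp u) - (2 : ℝ) • scalarOp (numberOp T) u - (m : ℝ) • u := by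
  induction u using TensorProduct.induction_on with
  | zero => simp
  | add u v hu hv => simp only [map_add, hu, hv]; module
  | tmul p a =>
    have h : ∀ i j, partialOp i (T j p) = T j (partialOp i p) + if i = j then p else 0 := by
      intro i j
      have := LinearMap.congr_fun (hT.partial_mul i j) p
      rw [Module.End.mul_apply, LinearMap.add_apply, Module.End.mul_apply] at this
      rw [this]
      split_ifs <;> rfl
    have h1 := sum_tmul_gen_mul_gen (fun i j => T j (partialOp i p)) a
    simp only [cliffOp_tmul, map_sum, scalarOp_tmul, h, TensorProduct.add_tmul,
      Finset.sum_add_distrib, TensorProduct.ite_tmul, Finset.sum_ite_eq',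
      Finset.mem_univ, if_true]
    have h2 : ∑ j, p ⊗ₜ[ℝ] (gen ℝ j * (gen ℝ j * a)) = -((m : ℝ) • p ⊗ₜ[ℝ] a) := by
      simp only [← mul_assoc, gen_mul_self, neg_mul, one_mul, TensorProduct.tmul_neg]
      simp [Nat.cast_smul_eq_nsmul]
    have h3 : numberOp T p = ∑ i, T i (partialOp i p) := by
      simp [numberOp, LinearMap.sum_apply]
    rw [h2, h3, Finset.sum_comm]
    rw [eq_sub_of_add_eq h1]
    abel

theorem numberOp_mul {T : Fin m → ScalarOp m} (hT : IsRaising T) (j : Fin m) :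
    numberOp T * T j = T j * numberOp T + T j := by
  have h : ∀ i, T i * partialOp i * T j =
      T j * (T i * partialOp i) + if i = j then T i else 0 := by
    intro i
    rw [mul_assoc, hT.partial_mul, mul_add, ← mul_assoc, hT.comm, mul_assoc]
    congr 1
    split_ifs <;> simp
  simp only [numberOp, Finset.sum_mul, Finset.mul_sum, h, Finset.sum_add_distrib]
  simp

theorem scalarOp_numberOp_cliffOp {T : Fin m → ScalarOp m} (hT : IsRaising T)
    (u : TensorPoly m) : scalarOp (numberOp T) (cliffOp T u) =
      cliffOp T (scalarOp (numberOp T) u) + cliffOp T u := by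
  induction u using TensorProduct.induction_on with
  | zero => simp
  | add u v hu hv => simp only [map_add, hu, hv]; abel
  | tmul p a =>
    have h : ∀ j, numberOp T (T j p) = T j (numberOp T p) + T j p := fun j =>
      LinearMap.congr_fun (numberOp_mul hT j) p
    simp only [cliffOp_tmul, scalarOp_tmul, map_sum, h, TensorProduct.add_tmul,
      Finset.sum_add_distrib]

theorem cliffOp_partialOp_sq (u : TensorPoly m) :
    cliffOp partialOp (cliffOp partialOp u) = -scalarOp (∑ j, partialOp j * partialOp j) u := by
  induction u using TensorProduct.induction_on with
  | zero => simp
  | add u v hu hv => simp only [map_add, hu, hv]; abel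
  | tmul p a =>
    have h1 := sum_tmul_gen_mul_gen (fun i j => partialOp i (partialOp j p)) a
    have h2 : ∑ i, ∑ j, partialOp i (partialOp j p) ⊗ₜ[ℝ] (gen ℝ j * (gen ℝ i * a)) =
        ∑ i, ∑ j, partialOp i (partialOp j p) ⊗ₜ[ℝ] (gen ℝ i * (gen ℝ j * a)) := by
      rw [Finset.sum_comm]
      refine Finset.sum_congr rfl fun i _ => Finset.sum_congr rfl fun j _ => ?_
      rw [partialOp_apply, partialOp_apply, pderiv_comm]
      rfl
    rw [h2] at h1
    have h3 : ∑ i, ∑ j, partialOp i (partialOp j p) ⊗ₜ[ℝ] (gen ℝ i * (gen ℝ j * a)) =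
        -((∑ i, partialOp i (partialOp i p)) ⊗ₜ[ℝ] a) := by
      -- Mixed partials commute, so the two double sums in `h1` are equal and each is half of the
      -- total.
      have e1 : ∀ X : TensorPoly m, X = (1 / 2 : ℝ) • (X + X) := fun X => by module
      have e2 : ∀ X : TensorPoly m, (1 / 2 : ℝ) • -((2 : ℝ) • X) = -X := fun X => by module
      exact (e1 _).trans ((congrArg (fun X => (1 / 2 : ℝ) • X) h1).trans (e2 _))
    simp only [cliffOp_tmul, map_sum, scalarOp_tmul]
    rw [Finset.sum_comm, h3]
    simp [LinearMap.sum_apply]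

/-! ### Powers of the raising operator on monogenic polynomials -/

/-- The factor by which the Dirac operator lowers the `l`-th power of the raising operator. -/
def lowerCoeff (m l k : ℕ) : ℝ := if Even l then l else m + 2 * k + l - 1

/-- This is the recursion that DT + TD = -2N - m forces when N has eigenvalue l + k. Its alternating
sign explains the parity split in the closed form. -/
theorem lowerCoeff_succ (m l k : ℕ) :
    lowerCoeff m (l + 1) k = m + 2 * (l + k) - lowerCoeff m l k := by
  unfold lowerCoeff
  by_cases h : Even l
  · rw [if_neg (by simpa [Nat.even_add_one] using h), if_pos h]; push_cast; ring
  · rw [if_pos (by simpa [Nat.even_add_one] using h), if_neg h]; push_cast; ring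

/-- Monogenic elements of degree `k`, with the degree measured by the number operator. -/
structure IsMonogenicTensor (T : Fin m → ScalarOp m) (k : ℕ) (u : TensorPoly m) : Prop where
  dirac_eq : cliffOp partialOp u = 0
  number_eq : scalarOp (numberOp T) u = (k : ℝ) • u

theorem numberOp_pow {T : Fin m → ScalarOp m} (hT : IsRaising T) {k : ℕ} {u : TensorPoly m}
    (hu : IsMonogenicTensor T k u) (l : ℕ) :
    scalarOp (numberOp T) ((cliffOp T ^ l) u) = ((l : ℝ) + k) • (cliffOp T ^ l) u := by
  induction l with
  | zero => simpa using hu.number_eq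
  | succ l ih =>
    rw [pow_succ', Module.End.mul_apply, scalarOp_numberOp_cliffOp hT, ih, map_smul]
    push_cast
    module

/-- The two identities feed each other: the anticommutator turns the value of T D T^l u into that of
D T^(l+1) u, and applying T to the latter gives the first identity for l + 1. -/
theorem cliffOp_dirac_pow {T : Fin m → ScalarOp m} (hT : IsRaising T) {k : ℕ} {u : TensorPoly m}
    (hu : IsMonogenicTensor T k u) (l : ℕ) :
    cliffOp T (cliffOp partialOp ((cliffOp T ^ l) u)) = -lowerCoeff m l k • (cliffOp T ^ l) u ∧
      cliffOp partialOp ((cliffOp T ^ (l + 1)) u) =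
        -lowerCoeff m (l + 1) k • (cliffOp T ^ l) u := by
  have step : ∀ l, cliffOp T (cliffOp partialOp ((cliffOp T ^ l) u)) =
      -lowerCoeff m l k • (cliffOp T ^ l) u → cliffOp partialOp ((cliffOp T ^ (l + 1)) u) =
        -lowerCoeff m (l + 1) k • (cliffOp T ^ l) u := by
    intro l ih
    rw [pow_succ', Module.End.mul_apply, cliffOp_anticomm hT, ih, numberOp_pow hT hu,
      lowerCoeff_succ]
    module
  induction l with
  | zero =>
    have h0 : cliffOp T (cliffOp partialOp ((cliffOp T ^ 0) u)) =
        -lowerCoeff m 0 k • (cliffOp T ^ 0) u := by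
      simp [hu.dirac_eq, lowerCoeff]
    exact ⟨h0, step 0 h0⟩
  | succ l ih =>
    have h0 : cliffOp T (cliffOp partialOp ((cliffOp T ^ (l + 1)) u)) =
        -lowerCoeff m (l + 1) k • (cliffOp T ^ (l + 1)) u := by
      rw [ih.2, map_smul, pow_succ' (cliffOp T) l, Module.End.mul_apply]
    exact ⟨h0, step _ h0⟩

/-! ### Clifford algebra-valued pairings -/

/-- The map `(a, b) ↦ a† b`. -/
def daggerMul (m : ℕ) : Cl ℝ m →ₗ[ℝ] Cl ℝ m →ₗ[ℝ] Cl ℝ m :=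
  LinearMap.mk₂ ℝ (fun a b => dagger a * b)
    (fun a a' b => by rw [dagger_add, add_mul])
    (fun c a b => by rw [dagger_smul, smul_mul_assoc]; rfl)
    (fun a b b' => mul_add _ _ _)
    (fun c a b => mul_smul_comm _ _ _)

/-- The Clifford algebra-valued extension of a bilinear form on scalar polynomials. -/
def pairing (B : ScalarPoly m →ₗ[ℝ] ScalarPoly m →ₗ[ℝ] ℝ) :
    TensorPoly m →ₗ[ℝ] TensorPoly m →ₗ[ℝ] Cl ℝ m :=
  (TensorProduct.map₂ B (daggerMul m)).compr₂ (TensorProduct.lid ℝ (Cl ℝ m)).toLinearMap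

@[simp] theorem pairing_tmul (B : ScalarPoly m →ₗ[ℝ] ScalarPoly m →ₗ[ℝ] ℝ) (p q : ScalarPoly m)
    (a b : Cl ℝ m) : pairing B (p ⊗ₜ a) (q ⊗ₜ b) = B p q • (dagger a * b) := rfl

theorem pairing_induction {f g : TensorPoly m →ₗ[ℝ] TensorPoly m →ₗ[ℝ] Cl ℝ m}
    (h : ∀ p a q b, f (p ⊗ₜ a) (q ⊗ₜ b) = g (p ⊗ₜ a) (q ⊗ₜ b)) : f = g :=
  TensorProduct.ext' fun p a => TensorProduct.ext' fun q b => h p a q b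

/-- The sign comes from e_j† = -e_j when the generator crosses the involution. -/
theorem pairing_cliffOp_left {B : ScalarPoly m →ₗ[ℝ] ScalarPoly m →ₗ[ℝ] ℝ}
    {L L' : Fin m → ScalarOp m} (h : ∀ j p q, B (L j p) q = B p (L' j q)) (u v : TensorPoly m) :
    pairing B (cliffOp L u) v = -pairing B u (cliffOp L' v) := by
  have : (pairing B).comp (cliffOp L) = -(pairing B).compl₂ (cliffOp L') := by
    refine pairing_induction fun p a q b => ?_
    simp [h, dagger_mul_real, dagger_gen_real, LinearMap.sum_apply, mul_assoc]
  exact LinearMap.congr_fun₂ this u v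

theorem pairing_scalarOp_left {B : ScalarPoly m →ₗ[ℝ] ScalarPoly m →ₗ[ℝ] ℝ}
    {L L' : ScalarOp m} (h : ∀ p q, B (L p) q = B p (L' q)) (u v : TensorPoly m) :
    pairing B (scalarOp L u) v = pairing B u (scalarOp L' v) := by
  have : (pairing B).comp (scalarOp L) = (pairing B).compl₂ (scalarOp L') := by
    refine pairing_induction fun p a q b => ?_
    simp [h]
  exact LinearMap.congr_fun₂ this u v

/-- A symmetric bilinear form for which the operators `Tⱼ` are adjoint to the derivatives. -/
structure IsAdjointForm (T : Fin m → ScalarOp m)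
    (B : ScalarPoly m →ₗ[ℝ] ScalarPoly m →ₗ[ℝ] ℝ) : Prop where
  symm : ∀ p q, B p q = B q p
  adjoint : ∀ j p q, B (T j p) q = B p (MvPolynomial.pderiv j q)

theorem IsAdjointForm.adjoint' {T : Fin m → ScalarOp m}
    {B : ScalarPoly m →ₗ[ℝ] ScalarPoly m →ₗ[ℝ] ℝ} (hB : IsAdjointForm T B) (j : Fin m)
    (p q : ScalarPoly m) : B (MvPolynomial.pderiv j p) q = B p (T j q) := by
  rw [hB.symm, ← hB.adjoint, hB.symm]

/-- The number operator is symmetric, because B(T_j ∂_j p, q) = B(∂_j p, ∂_j q), and eigenvectors of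
a symmetric operator for distinct eigenvalues are orthogonal. -/
theorem pairing_eq_zero_of_ne {T : Fin m → ScalarOp m}
    {B : ScalarPoly m →ₗ[ℝ] ScalarPoly m →ₗ[ℝ] ℝ} (hB : IsAdjointForm T B) {k k' : ℕ}
    (hk : k ≠ k') {u v : TensorPoly m} (hu : IsMonogenicTensor T k u)
    (hv : IsMonogenicTensor T k' v) : pairing B u v = 0 := by
  have h := pairing_scalarOp_left (B := B) (L := numberOp T) (L' := numberOp T) (fun p q => by
    simp only [numberOp, LinearMap.sum_apply, map_sum, Module.End.mul_apply, hB.adjoint,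
      partialOp_apply, ← hB.adjoint']) u v
  rw [hu.number_eq, hv.number_eq, map_smul, map_smul, LinearMap.smul_apply, ← sub_eq_zero,
    ← sub_smul, smul_eq_zero, sub_eq_zero] at h
  exact h.resolve_left (by exact_mod_cast hk)

/-- The product of the first `l` lowering factors. -/
def lowerProd (m l k : ℕ) : ℝ := ∏ i ∈ Finset.range l, lowerCoeff m (i + 1) k

/-- Each T moved from the left becomes -D on the right and removes one T there, producing a lowering
factor; the two signs cancel. If the exponents differ, D finally meets a monogenic element. -/
theorem pairing_pow {T : Fin m → ScalarOp m} (hT : IsRaising T)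
    {B : ScalarPoly m →ₗ[ℝ] ScalarPoly m →ₗ[ℝ] ℝ} (hB : IsAdjointForm T B) {k k' : ℕ}
    {u v : TensorPoly m} (hu : IsMonogenicTensor T k u) (hv : IsMonogenicTensor T k' v)
    (l l' : ℕ) : pairing B ((cliffOp T ^ l) u) ((cliffOp T ^ l') v) =
      if l = l' then lowerProd m l k' • pairing B u v else 0 := by
  have h1 : ∀ x y, pairing B (cliffOp T x) y = -pairing B x (cliffOp partialOp y) :=
    pairing_cliffOp_left hB.adjoint
  have h2 : ∀ x y, pairing B (cliffOp partialOp x) y = -pairing B x (cliffOp T y) :=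
    pairing_cliffOp_left hB.adjoint'
  induction l generalizing l' with
  | zero =>
    cases l' with
    | zero => simp [lowerProd]
    | succ l' =>
      have := h2 u ((cliffOp T ^ l') v)
      rw [hu.dirac_eq, map_zero, LinearMap.zero_apply, zero_eq_neg] at this
      rw [pow_succ', Module.End.mul_apply, pow_zero, Module.End.one_apply, this, if_neg (by simp)]
  | succ l ih =>
    rw [pow_succ', Module.End.mul_apply, h1]
    cases l' with
    | zero =>
      rw [pow_zero, Module.End.one_apply, hv.dirac_eq, map_zero, neg_zero, if_neg (by simp)]
    | succ l' =>
      rw [(cliffOp_dirac_pow hT hv l').2, map_smul, ih l']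
      by_cases h : l = l'
      · subst h
        simp [lowerProd, Finset.prod_range_succ, smul_smul, mul_comm]
      · simp [h]

/-! ### Harmonic polynomials -/

/-- Harmonic homogeneous polynomials. -/
structure IsHarmonic (k : ℕ) (p : ScalarPoly m) : Prop where
  homogeneous : p.IsHomogeneous k
  laplace : ∑ j, MvPolynomial.pderiv j (MvPolynomial.pderiv j p) = 0

theorem IsHarmonic.pderiv {k : ℕ} {p : ScalarPoly m} (hp : IsHarmonic (k + 1) p) (i : Fin m) :
    IsHarmonic k (MvPolynomial.pderiv i p) where
  homogeneous := hp.homogeneous.pderiv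
  laplace := by
    simp only [pderiv_comm _ i]
    rw [← map_sum, hp.laplace, map_zero]

theorem IsHarmonic.eq_C {p : ScalarPoly m} (hp : IsHarmonic 0 p) : ∃ c, p = MvPolynomial.C c :=
  ⟨_, MvPolynomial.totalDegree_eq_zero_iff_eq_C.1 (Nat.le_zero.1 hp.homogeneous.totalDegree_le)⟩

theorem IsHarmonic.numberOp_varOp {k : ℕ} {p : ScalarPoly m} (hp : IsHarmonic k p) :
    ∑ j, varOp j (MvPolynomial.pderiv j p) = (k : ℝ) • p := by
  simp only [varOp_apply]
  rw [hp.homogeneous.sum_X_mul_pderiv, Nat.cast_smul_eq_nsmul]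

/-- ∑ (x_j - ∂_j) ∂_j is the Euler operator minus the Laplacian. -/
theorem IsHarmonic.numberOp_gaussOp {k : ℕ} {p : ScalarPoly m} (hp : IsHarmonic k p) :
    ∑ j, gaussOp j (MvPolynomial.pderiv j p) = (k : ℝ) • p := by
  simp only [gaussOp_apply, Finset.sum_sub_distrib, hp.laplace, sub_zero]
  exact hp.numberOp_varOp

/-- Write kp as ∑ T_j ∂_j p and move T_j across: k B(p, q) = ∑ B(∂_j p, ∂_j q). The right side
involves harmonic polynomials of lower degree and no longer mentions T, so the value on constants
decides everything. -/
theorem IsHarmonic.form_eq {T T' : Fin m → ScalarOp m}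
    {B B' : ScalarPoly m →ₗ[ℝ] ScalarPoly m →ₗ[ℝ] ℝ} (hB : IsAdjointForm T B)
    (hB' : IsAdjointForm T' B') (h1 : B 1 1 = B' 1 1)
    (hT : ∀ k (p : ScalarPoly m), IsHarmonic k p →
      ∑ j, T j (MvPolynomial.pderiv j p) = (k : ℝ) • p)
    (hT' : ∀ k (p : ScalarPoly m), IsHarmonic k p →
      ∑ j, T' j (MvPolynomial.pderiv j p) = (k : ℝ) • p)
    {k : ℕ} {p q : ScalarPoly m} (hp : IsHarmonic k p) (hq : IsHarmonic k q) :
    B p q = B' p q := by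
  induction k generalizing p q with
  | zero =>
    obtain ⟨c, rfl⟩ := hp.eq_C
    obtain ⟨c', rfl⟩ := hq.eq_C
    have hC : ∀ c : ℝ, (MvPolynomial.C c : ScalarPoly m) = c • 1 := fun c => by
      rw [MvPolynomial.smul_eq_C_mul, mul_one]
    simp only [hC, map_smul, LinearMap.smul_apply, h1]
  | succ k ih =>
    have h : ((k + 1 : ℕ) : ℝ) • B p q = ((k + 1 : ℕ) : ℝ) • B' p q := by
      have e : ∀ B : ScalarPoly m →ₗ[ℝ] ScalarPoly m →ₗ[ℝ] ℝ,
          ((k + 1 : ℕ) : ℝ) • B p q = B (((k + 1 : ℕ) : ℝ) • p) q := fun B => by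
        rw [map_smul, LinearMap.smul_apply]
      rw [e, e]
      nth_rewrite 1 [← hT _ _ hp]
      rw [← hT' _ _ hp]
      simp only [map_sum, LinearMap.sum_apply, hB.adjoint, hB'.adjoint]
      exact Finset.sum_congr rfl fun j _ => ih (hp.pderiv j) (hq.pderiv j)
    exact smul_right_injective _ (Nat.cast_ne_zero.2 k.succ_ne_zero) h

/-- For harmonic p, kp equals both ∑ (x_j - ∂_j) ∂_j p and ∑ x_j ∂_j p. The functional S acts well
on the first sum and evaluation at z on the second, and both reduce to the derivatives of p. -/
theorem IsHarmonic.functional_eq {S : ScalarPoly m →ₗ[ℝ] ℂ} {z : Fin m → ℂ} (h1 : S 1 = 1)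
    (hS : ∀ j p, S (gaussOp j p) = z j * S p) {k : ℕ} {p : ScalarPoly m} (hp : IsHarmonic k p) :
    S p = MvPolynomial.aeval z p := by
  induction k generalizing p with
  | zero =>
    obtain ⟨c, rfl⟩ := hp.eq_C
    rw [← mul_one (MvPolynomial.C c), ← MvPolynomial.smul_eq_C_mul, map_smul, h1, map_smul, map_one]
  | succ k ih =>
    have h : ((k + 1 : ℕ) : ℝ) • S p = ((k + 1 : ℕ) : ℝ) • MvPolynomial.aeval z p := by
      rw [← map_smul, ← map_smul]
      nth_rewrite 1 [← hp.numberOp_gaussOp]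
      rw [← hp.numberOp_varOp, map_sum, map_sum]
      refine Finset.sum_congr rfl fun j _ => ?_
      rw [hS, ih (hp.pderiv j), varOp_apply, map_mul, MvPolynomial.aeval_X]
    exact smul_right_injective _ (Nat.cast_ne_zero.2 k.succ_ne_zero) h

/-! ### Components and evaluation -/

/-- The component of a Clifford polynomial with respect to a blade. -/
def component (A : Finset (Fin m)) : TensorPoly m →ₗ[ℝ] ScalarPoly m :=
  (TensorProduct.rid ℝ (ScalarPoly m)).toLinearMap ∘ₗ
    LinearMap.lTensor (ScalarPoly m) ((bladeBasis ℝ m).coord A)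

@[simp] theorem component_tmul (A : Finset (Fin m)) (p : ScalarPoly m) (a : Cl ℝ m) :
    component A (p ⊗ₜ a) = (bladeBasis ℝ m).repr a A • p := rfl

theorem sum_component (u : TensorPoly m) : ∑ A, component A u ⊗ₜ blade ℝ A = u := by
  have : ∑ A, ((TensorProduct.mk ℝ (ScalarPoly m) (Cl ℝ m)).flip (blade ℝ A)) ∘ₗ component A =
      LinearMap.id := by
    refine TensorProduct.ext' fun p a => ?_
    simp only [LinearMap.sum_apply, LinearMap.comp_apply, component_tmul, LinearMap.flip_apply,
      TensorProduct.mk_apply, LinearMap.id_apply, TensorProduct.smul_tmul, ← TensorProduct.tmul_sum,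
      sum_repr_smul_blade]
  simpa [LinearMap.sum_apply] using LinearMap.congr_fun this u

theorem component_ext {u v : TensorPoly m} (h : ∀ A, component A u = component A v) : u = v := by
  rw [← sum_component u, ← sum_component v]
  simp only [h]

theorem component_scalarOp (A : Finset (Fin m)) (L : ScalarOp m) (u : TensorPoly m) :
    component A (scalarOp L u) = L (component A u) := by
  have : component A ∘ₗ scalarOp L = L ∘ₗ component A :=
    TensorProduct.ext' fun p a => by simp
  exact LinearMap.congr_fun this u

/-- A Clifford polynomial as a tensor. -/
def CliffordPoly.toTensor (P : CliffordPoly m) : TensorPoly m :=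
  ∑ A, P A ⊗ₜ blade ℝ A

@[simp] theorem component_toTensor (A : Finset (Fin m)) (P : CliffordPoly m) :
    component A P.toTensor = P A := by
  simp [CliffordPoly.toTensor, repr_blade, Finsupp.single_apply]

/-- The Clifford algebra-valued extension of a real functional. -/
def applyReal (S : ScalarPoly m →ₗ[ℝ] ℝ) : TensorPoly m →ₗ[ℝ] Cl ℝ m :=
  (TensorProduct.lid ℝ (Cl ℝ m)).toLinearMap ∘ₗ LinearMap.rTensor (Cl ℝ m) S

@[simp] theorem applyReal_tmul (S : ScalarPoly m →ₗ[ℝ] ℝ) (p : ScalarPoly m) (a : Cl ℝ m) :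
    applyReal S (p ⊗ₜ a) = S p • a := rfl

/-- The complex Clifford algebra-valued extension of a complex functional. -/
def applyComplex (S : ScalarPoly m →ₗ[ℝ] ℂ) : TensorPoly m →ₗ[ℝ] Cl ℂ m :=
  TensorProduct.lift (LinearMap.mk₂ ℝ (fun p a => S p • complexifyHom m a)
    (fun p q a => by rw [map_add, add_smul])
    (fun c p a => by rw [map_smul, smul_assoc])
    (fun p a b => by rw [map_add, smul_add])
    (fun c p a => by rw [map_smul, smul_comm]))

@[simp] theorem applyComplex_tmul (S : ScalarPoly m →ₗ[ℝ] ℂ) (p : ScalarPoly m) (a : Cl ℝ m) :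
    applyComplex S (p ⊗ₜ a) = S p • complexifyHom m a := rfl

theorem applyComplex_cliffOp {S : ScalarPoly m →ₗ[ℝ] ℂ} {T : Fin m → ScalarOp m} {z : Fin m → ℂ}
    (h : ∀ j p, S (T j p) = z j * S p) (u : TensorPoly m) :
    applyComplex S (cliffOp T u) = vec z * applyComplex S u := by
  have : applyComplex S ∘ₗ cliffOp T = LinearMap.mulLeft ℝ (vec z) ∘ₗ applyComplex S :=
    TensorProduct.ext' fun p a => by
      simp [h, vec, Finset.sum_mul, complexifyHom_gen, Finset.smul_sum, smul_smul, mul_comm (S p)]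
  exact LinearMap.congr_fun this u

theorem applyComplex_cliffOp_pow {S : ScalarPoly m →ₗ[ℝ] ℂ} {T : Fin m → ScalarOp m}
    {z : Fin m → ℂ} (h : ∀ j p, S (T j p) = z j * S p) (l : ℕ) (u : TensorPoly m) :
    applyComplex S ((cliffOp T ^ l) u) = vec z ^ l * applyComplex S u := by
  induction l with
  | zero => simp
  | succ l ih =>
    rw [pow_succ', Module.End.mul_apply, applyComplex_cliffOp h, ih, pow_succ', mul_assoc]

theorem applyReal_eq_sum (S : ScalarPoly m →ₗ[ℝ] ℝ) (u : TensorPoly m) :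
    applyReal S u = ∑ A, S (component A u) • blade ℝ A := by
  conv_lhs => rw [← sum_component u]
  simp

theorem applyComplex_eq_sum (S : ScalarPoly m →ₗ[ℝ] ℂ) (u : TensorPoly m) :
    applyComplex S u = ∑ A, S (component A u) • blade ℂ A := by
  conv_lhs => rw [← sum_component u]
  simp [complexifyHom_blade]

/-- Evaluation of scalar polynomials at a real point. -/
def evalAt (x : EuclideanSpace ℝ (Fin m)) : ScalarPoly m →ₗ[ℝ] ℝ :=
  (MvPolynomial.aeval (fun j => x j)).toLinearMap

/-- Evaluation of scalar polynomials at a complex point. -/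
def evalAtComplex (z : Fin m → ℂ) : ScalarPoly m →ₗ[ℝ] ℂ := (MvPolynomial.aeval z).toLinearMap

@[simp] theorem evalAt_apply (x : EuclideanSpace ℝ (Fin m)) (p : ScalarPoly m) :
    evalAt x p = MvPolynomial.eval (fun j => x j) p := by
  simp [evalAt, MvPolynomial.aeval_eq_eval]

@[simp] theorem evalAtComplex_apply (z : Fin m → ℂ) (p : ScalarPoly m) :
    evalAtComplex z p = MvPolynomial.aeval z p := rfl

theorem evalReal_eq (P : CliffordPoly m) (x : EuclideanSpace ℝ (Fin m)) :
    P.evalReal x = applyReal (evalAt x) P.toTensor := by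
  simp [applyReal_eq_sum, CliffordPoly.evalReal]

theorem evalComplex_eq (P : CliffordPoly m) (z : Fin m → ℂ) :
    P.evalComplex z = applyComplex (evalAtComplex z) P.toTensor := by
  simp [applyComplex_eq_sum, CliffordPoly.evalComplex]

theorem vecPowMul_eq (l : ℕ) (P : CliffordPoly m) (z : Fin m → ℂ) :
    vecPowMul l P z = applyComplex (evalAtComplex z) ((cliffOp varOp ^ l) P.toTensor) := by
  rw [applyComplex_cliffOp_pow (z := z) (fun j p => by simp), vecPowMul, evalComplex_eq]

theorem repr_applyReal (S : ScalarPoly m →ₗ[ℝ] ℝ) (u : TensorPoly m) (A : Finset (Fin m)) :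
    (bladeBasis ℝ m).repr (applyReal S u) A = S (component A u) := by
  rw [applyReal_eq_sum, map_sum, Finsupp.finsetSum_apply]
  simp [repr_blade, Finsupp.single_apply]

/-- A real polynomial is determined by its values on ℝ^m. This transfers the analytic Dirac equation
to an identity of polynomials. -/
theorem eq_of_applyReal_evalAt {u v : TensorPoly m}
    (h : ∀ x, applyReal (evalAt x) u = applyReal (evalAt x) v) : u = v := by
  refine component_ext fun A => MvPolynomial.funext fun x => ?_
  have := congrArg (fun a => (bladeBasis ℝ m).repr a A) (h (WithLp.toLp 2 x))
  simpa only [repr_applyReal, evalAt_apply] using this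

/-- Multiplication of Clifford polynomials by a constant from the right. -/
def mulRightOp (a : Cl ℝ m) : Module.End ℝ (TensorPoly m) :=
  LinearMap.lTensor (ScalarPoly m) (LinearMap.mulRight ℝ a)

theorem applyReal_mulRightOp (S : ScalarPoly m →ₗ[ℝ] ℝ) (a : Cl ℝ m) (u : TensorPoly m) :
    applyReal S (mulRightOp a u) = applyReal S u * a := by
  have : applyReal S ∘ₗ mulRightOp a = LinearMap.mulRight ℝ a ∘ₗ applyReal S :=
    TensorProduct.ext' fun p b => by simp [mulRightOp]
  exact LinearMap.congr_fun this u

theorem applyComplex_mulRightOp (S : ScalarPoly m →ₗ[ℝ] ℂ) (a : Cl ℝ m) (u : TensorPoly m) :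
    applyComplex S (mulRightOp a u) = applyComplex S u * complexifyHom m a := by
  have : applyComplex S ∘ₗ mulRightOp a =
      LinearMap.mulRight ℝ (complexifyHom m a) ∘ₗ applyComplex S :=
    TensorProduct.ext' fun p b => by simp [mulRightOp]
  exact LinearMap.congr_fun this u

end TensorPolynomials

/-! ### Gaussian moments and the Gaussian form -/

section GaussianIntegrals

variable {m : ℕ}

/-- The Gaussian kernel `exp(-w² / 2 + x w - x² / 2)` in one variable. -/
def gaussKernelOne (w : ℂ) (x : ℝ) : ℂ := Complex.exp (-(w * w) / 2 + x * w - x * x / 2)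

theorem hasDerivAt_gaussKernelOne (w : ℂ) (x : ℝ) :
    HasDerivAt (gaussKernelOne w) ((w - x) * gaussKernelOne w x) x := by
  have hx : HasDerivAt (fun x : ℝ => (x : ℂ)) 1 x := Complex.ofRealCLM.hasDerivAt
  have h := ((((hx.mul_const w).const_add (-(w * w) / 2)).sub ((hx.mul hx).div_const 2)).cexp)
  refine h.congr_deriv ?_
  rw [mul_comm]
  congr 1
  ring

/-- The power is dominated by n! (exp x + exp(-x)), and an exponential factor merely shifts the
linear parameter of the Gaussian. -/
theorem integrable_pow_mul_gaussKernelOne (w : ℂ) (n : ℕ) :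
    Integrable fun x : ℝ => (x : ℂ) ^ n * gaussKernelOne w x := by
  have h1 : ∀ s : ℂ, Integrable fun x : ℝ => Complex.exp (s * x) * gaussKernelOne w x := by
    intro s
    have := integrable_cexp_quadratic' (b := -1 / 2) (by norm_num) (s + w) (-(w * w) / 2)
    refine this.congr (Filter.Eventually.of_forall fun x => ?_)
    simp only [gaussKernelOne]
    rw [← Complex.exp_add]
    congr 1
    ring
  have h2 : Continuous (gaussKernelOne w) :=
    continuous_iff_continuousAt.2 fun x => (hasDerivAt_gaussKernelOne w x).continuousAt
  refine Integrable.mono' (((h1 1).norm.add (h1 (-1)).norm).const_mul (n.factorial : ℝ))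
    (by fun_prop) (Filter.Eventually.of_forall fun x => ?_)
  have h3 : |x| ^ n ≤ n.factorial * Real.exp |x| := by
    have := Real.pow_div_factorial_le_exp |x| (abs_nonneg x) n
    rwa [div_le_iff₀' (by positivity)] at this
  have h4 : Real.exp |x| ≤ Real.exp x + Real.exp (-x) := by
    rcases abs_cases x with ⟨h, _⟩ | ⟨h, _⟩ <;> rw [h] <;>
      linarith [Real.exp_pos x, Real.exp_pos (-x)]
  simp only [Pi.add_apply, norm_mul, norm_pow, Complex.norm_real, Real.norm_eq_abs,
    Complex.norm_exp]
  rw [← add_mul, ← mul_assoc]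
  refine mul_le_mul_of_nonneg_right ?_ (norm_nonneg _)
  simp only [one_mul, neg_mul, Complex.neg_re, Complex.ofReal_re]
  exact h3.trans (mul_le_mul_of_nonneg_left h4 (by positivity))

/-- The moments of the one-dimensional Gaussian kernel. -/
def gaussMoment (w : ℂ) (n : ℕ) : ℂ :=
  (√(2 * Real.pi))⁻¹ • ∫ x : ℝ, (x : ℂ) ^ n * gaussKernelOne w x

theorem gaussMoment_zero (w : ℂ) : gaussMoment w 0 = 1 := by
  have h := integral_cexp_quadratic (b := -1 / 2) (by norm_num) w (-(w * w) / 2)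
  have h2 : ∀ x : ℝ, (x : ℂ) ^ 0 * gaussKernelOne w x =
      Complex.exp (-1 / 2 * (x : ℂ) ^ 2 + w * x + -(w * w) / 2) := by
    intro x
    rw [pow_zero, one_mul, gaussKernelOne]
    congr 1
    ring
  rw [gaussMoment, funext h2, h]
  -- Completing the square cancels the factor exp(-w²/2) of the kernel, so the mass does not depend
  -- on w.
  have h3 : -(w * w) / 2 - w ^ 2 / (4 * (-1 / 2)) = 0 := by ring
  have h4 : (Real.pi : ℂ) / -(-1 / 2) = ((2 * Real.pi : ℝ) : ℂ) := by push_cast; ring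
  have h5 : ((2 * Real.pi : ℝ) : ℂ) ^ (1 / 2 : ℂ) = ((√(2 * Real.pi) : ℝ) : ℂ) := by
    rw [Real.sqrt_eq_rpow, Complex.ofReal_cpow (by positivity)]
    norm_num
  rw [h3, h4, h5, Complex.exp_zero, mul_one, Complex.real_smul, ← Complex.ofReal_mul,
    inv_mul_cancel₀ (by positivity), Complex.ofReal_one]

/-- The derivative of x^n times the kernel has integral zero. For n = 0 the truncated n - 1 is
harmless because its coefficient vanishes. -/
theorem gaussMoment_succ (w : ℂ) (n : ℕ) :
    gaussMoment w (n + 1) = w * gaussMoment w n + n * gaussMoment w (n - 1) := by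
  have hd : ∀ x : ℝ, HasDerivAt (fun x : ℝ => (x : ℂ) ^ n * gaussKernelOne w x)
      (n * ((x : ℂ) ^ (n - 1) * gaussKernelOne w x) + w * ((x : ℂ) ^ n * gaussKernelOne w x) -
        (x : ℂ) ^ (n + 1) * gaussKernelOne w x) x := by
    intro x
    have hx : HasDerivAt (fun x : ℝ => (x : ℂ)) 1 x := Complex.ofRealCLM.hasDerivAt
    refine ((hx.pow n).mul (hasDerivAt_gaussKernelOne w x)).congr_deriv ?_
    simp only [Pi.pow_apply]
    ring
  have i1 := (integrable_pow_mul_gaussKernelOne w (n - 1)).const_mul (n : ℂ)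
  have i2 := (integrable_pow_mul_gaussKernelOne w n).const_mul w
  have i3 := integrable_pow_mul_gaussKernelOne w (n + 1)
  have i4 : Integrable fun x : ℝ => n * ((x : ℂ) ^ (n - 1) * gaussKernelOne w x) +
      w * ((x : ℂ) ^ n * gaussKernelOne w x) := i1.add i2
  have h := integral_eq_zero_of_hasDerivAt_of_integrable hd (i4.sub i3)
    (integrable_pow_mul_gaussKernelOne w n)
  rw [integral_sub i4 i3, integral_add i1 i2, integral_const_mul, integral_const_mul,
    sub_eq_zero] at h
  simp only [gaussMoment, ← h, Complex.real_smul]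
  ring

/-- The kernel `exp(-z⬝z / 2 + x⬝z - x⬝x / 2)`. -/
def gaussKernel (z : Fin m → ℂ) (x : EuclideanSpace ℝ (Fin m)) : ℂ :=
  Complex.exp (-(∑ j, z j * z j) / 2 + ∑ j, (x j : ℂ) * z j - (∑ j, (x j : ℂ) * (x j : ℂ)) / 2)

theorem gaussKernel_eq_prod (z : Fin m → ℂ) (x : EuclideanSpace ℝ (Fin m)) :
    gaussKernel z x = ∏ j, gaussKernelOne (z j) (x j) := by
  simp only [gaussKernel, gaussKernelOne, ← Complex.exp_sum, Finset.sum_add_distrib,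
    Finset.sum_sub_distrib, ← Finset.sum_div, Finset.sum_neg_distrib]

theorem eval_monomial_eq (s : Fin m →₀ ℕ) (c : ℝ) (x : Fin m → ℝ) :
    MvPolynomial.eval x (MvPolynomial.monomial s c) = c * ∏ j, x j ^ s j := by
  rw [MvPolynomial.eval_monomial, Finsupp.prod_fintype _ _ (by simp)]

theorem gaussKernel_mul_monomial (z : Fin m → ℂ) (s : Fin m →₀ ℕ) (c : ℝ)
    (x : EuclideanSpace ℝ (Fin m)) :
    gaussKernel z x * (MvPolynomial.eval (fun j => x j) (MvPolynomial.monomial s c) : ℝ) =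
      c * ∏ j, ((x j : ℂ) ^ s j * gaussKernelOne (z j) (x j)) := by
  rw [eval_monomial_eq, gaussKernel_eq_prod, Finset.prod_mul_distrib]
  push_cast
  ring

theorem integrable_gaussKernel_mul (z : Fin m → ℂ) (p : ScalarPoly m) :
    Integrable fun x : EuclideanSpace ℝ (Fin m) =>
      gaussKernel z x * (MvPolynomial.eval (fun j => x j) p : ℝ) := by
  induction p using MvPolynomial.induction_on' with
  | monomial s c =>
    simp only [gaussKernel_mul_monomial]
    refine Integrable.const_mul ?_ _
    rw [← (PiLp.volume_preserving_toLp (Fin m)).integrable_comp_emb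
      (MeasurableEquiv.toLp 2 _).measurableEmbedding]
    exact Integrable.fintype_prod (f := fun j (t : ℝ) => (t : ℂ) ^ s j * gaussKernelOne (z j) t)
      fun j => integrable_pow_mul_gaussKernelOne (z j) (s j)
  | add p q hp hq =>
    simp only [map_add, Complex.ofReal_add, mul_add]
    exact hp.add hq

/-- The functional `p ↦ (2π) ^ (-m/2) ∫ exp(-z⬝z / 2 + x⬝z - x⬝x / 2) p(x) dx`. -/
def gaussFunctional (z : Fin m → ℂ) : ScalarPoly m →ₗ[ℝ] ℂ where
  toFun p := (√(2 * Real.pi) ^ m)⁻¹ • ∫ x : EuclideanSpace ℝ (Fin m),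
    gaussKernel z x * (MvPolynomial.eval (fun j => x j) p : ℝ)
  map_add' p q := by
    simp only [map_add, Complex.ofReal_add, mul_add]
    rw [integral_add (integrable_gaussKernel_mul z p) (integrable_gaussKernel_mul z q), smul_add]
  map_smul' c p := by
    simp only [MvPolynomial.smul_eval, Complex.ofReal_mul, mul_left_comm _ (c : ℂ)]
    rw [integral_const_mul, RingHom.id_apply, ← Complex.real_smul, smul_comm]

theorem gaussFunctional_apply (z : Fin m → ℂ) (p : ScalarPoly m) :
    gaussFunctional z p = (√(2 * Real.pi) ^ m)⁻¹ • ∫ x : EuclideanSpace ℝ (Fin m),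
      gaussKernel z x * (MvPolynomial.eval (fun j => x j) p : ℝ) := rfl

theorem gaussFunctional_monomial (z : Fin m → ℂ) (s : Fin m →₀ ℕ) (c : ℝ) :
    gaussFunctional z (MvPolynomial.monomial s c) = c * ∏ j, gaussMoment (z j) (s j) := by
  simp only [gaussFunctional_apply, gaussKernel_mul_monomial]
  rw [integral_const_mul, ← (PiLp.volume_preserving_toLp (Fin m)).integral_comp
      (MeasurableEquiv.toLp 2 _).measurableEmbedding]
  have h := integral_fintype_prod_volume_eq_prod
    (f := fun (j : Fin m) (t : ℝ) => (t : ℂ) ^ s j * gaussKernelOne (z j) t)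
  refine (congrArg (fun I : ℂ => (√(2 * Real.pi) ^ m)⁻¹ • ((c : ℂ) * I)) h).trans ?_
  simp only [gaussMoment, Finset.prod_smul, Finset.prod_const, Finset.card_univ, Fintype.card_fin,
    inv_pow]
  rw [mul_smul_comm]

theorem gaussFunctional_one (z : Fin m → ℂ) : gaussFunctional z 1 = 1 := by
  have h := gaussFunctional_monomial z 0 1
  simpa [gaussMoment_zero] using h

theorem prod_eq_mul_prod_erase {M : Type*} [CommMonoid M] (f : Fin m → ℕ → M) (s : Fin m →₀ ℕ)
    (j : Fin m) (g : Fin m →₀ ℕ) (hg : ∀ i ≠ j, g i = s i) :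
    ∏ i, f i (g i) = f j (g j) * ∏ i ∈ Finset.univ.erase j, f i (s i) := by
  rw [← Finset.mul_prod_erase _ _ (Finset.mem_univ j)]
  congr 1
  exact Finset.prod_congr rfl fun i hi => by rw [hg i (Finset.ne_of_mem_erase hi)]

/-- Integration by parts, carried out on monomials, where the integral factors and only the j-th
moment changes. -/
theorem gaussFunctional_X_mul (z : Fin m → ℂ) (j : Fin m) (p : ScalarPoly m) :
    gaussFunctional z (MvPolynomial.X j * p) =
      z j * gaussFunctional z p + gaussFunctional z (MvPolynomial.pderiv j p) := by
  induction p using MvPolynomial.induction_on' with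
  | monomial s c =>
    have h : MvPolynomial.X j * MvPolynomial.monomial s c =
        MvPolynomial.monomial (s + Finsupp.single j 1) c := by
      rw [MvPolynomial.monomial_add_single, pow_one, mul_comm]
    rw [h, MvPolynomial.pderiv_monomial]
    simp only [gaussFunctional_monomial]
    rw [prod_eq_mul_prod_erase (fun i n => gaussMoment (z i) n) s j (s + Finsupp.single j 1)
      fun i hi => by simp [hi.symm], prod_eq_mul_prod_erase (fun i n => gaussMoment (z i) n) s j s
      fun i _ => rfl, prod_eq_mul_prod_erase (fun i n => gaussMoment (z i) n) s j
        (s - Finsupp.single j 1)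
      fun i hi => by simp [hi.symm]]
    simp only [Finsupp.add_apply, Finsupp.tsub_apply, Finsupp.single_eq_same, gaussMoment_succ]
    push_cast
    ring
  | add p q hp hq => simp only [mul_add, map_add, hp, hq]; ring

theorem gaussFunctional_gaussOp (z : Fin m → ℂ) (j : Fin m) (p : ScalarPoly m) :
    gaussFunctional z (gaussOp j p) = z j * gaussFunctional z p := by
  rw [gaussOp_apply, map_sub, gaussFunctional_X_mul, add_sub_cancel_right]

/-- The bilinear form `(2π) ^ (-m/2) ∫ p(x) q(x) exp(-|x|² / 2) dx`. -/
def gaussForm (m : ℕ) : ScalarPoly m →ₗ[ℝ] ScalarPoly m →ₗ[ℝ] ℝ :=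
  (LinearMap.mul ℝ (ScalarPoly m)).compr₂ (Complex.reLm ∘ₗ gaussFunctional 0)

theorem gaussForm_apply (p q : ScalarPoly m) :
    gaussForm m p q = (gaussFunctional 0 (p * q)).re := rfl

/-- At z = 0 integration by parts reads ∫ x_j pq = ∫ ∂_j(pq) against the Gaussian; the Leibniz rule
does the rest. -/
theorem isAdjointForm_gaussForm : IsAdjointForm gaussOp (gaussForm m) where
  symm p q := by rw [gaussForm_apply, gaussForm_apply, mul_comm]
  adjoint j p q := by
    have h := gaussFunctional_X_mul 0 j (p * q)
    rw [Pi.zero_apply, zero_mul, zero_add, Derivation.leibniz, map_add] at h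
    rw [gaussForm_apply, gaussForm_apply, gaussOp_apply, sub_mul, map_sub, mul_assoc, h]
    simp [mul_comm]

theorem gaussForm_one_one : gaussForm m 1 1 = 1 := by
  rw [gaussForm_apply, mul_one, gaussFunctional_one, Complex.one_re]

theorem gaussKernel_zero (x : EuclideanSpace ℝ (Fin m)) :
    gaussKernel 0 x = (Real.exp (-‖x‖ ^ 2 / 2) : ℝ) := by
  rw [gaussKernel, EuclideanSpace.real_norm_sq_eq, Complex.ofReal_exp]
  congr 1
  push_cast
  simp [sq, neg_div]

theorem integrable_exp_mul_eval (p : ScalarPoly m) : Integrable fun x : EuclideanSpace ℝ (Fin m) =>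
    Real.exp (-‖x‖ ^ 2 / 2) * MvPolynomial.eval (fun j => x j) p := by
  have h := (integrable_gaussKernel_mul 0 p).re
  refine h.congr (Filter.Eventually.of_forall fun x => ?_)
  simp only [gaussKernel_zero]
  rw [← Complex.ofReal_mul]
  exact Complex.ofReal_re _

theorem gaussForm_eq_integral (p q : ScalarPoly m) : gaussForm m p q =
    (√(2 * Real.pi) ^ m)⁻¹ * ∫ x : EuclideanSpace ℝ (Fin m), Real.exp (-‖x‖ ^ 2 / 2) *
      (MvPolynomial.eval (fun j => x j) p * MvPolynomial.eval (fun j => x j) q) := by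
  rw [gaussForm_apply, gaussFunctional_apply]
  simp only [gaussKernel_zero, ← Complex.ofReal_mul, map_mul]
  rw [Complex.real_smul, Complex.re_ofReal_mul]
  congr 1
  exact congrArg Complex.re integral_ofReal

theorem pairing_eq_sum (B : ScalarPoly m →ₗ[ℝ] ScalarPoly m →ₗ[ℝ] ℝ) (u v : TensorPoly m) :
    pairing B u v = ∑ A, ∑ A', B (component A u) (component A' v) •
      (dagger (blade ℝ A) * blade ℝ A') := by
  conv_lhs => rw [← sum_component u, ← sum_component v]
  simp only [map_sum, LinearMap.sum_apply, pairing_tmul]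
  exact Finset.sum_comm

theorem dagger_sum {𝕜 : Type} [RCLike 𝕜] {ι : Type*} (s : Finset ι) (f : ι → Cl 𝕜 m) :
    dagger (∑ i ∈ s, f i) = ∑ i ∈ s, dagger (f i) := map_sum (daggerₗ 𝕜 m) _ _

theorem dagger_applyReal_mul (S : ScalarPoly m →ₗ[ℝ] ℝ) (u v : TensorPoly m) :
    dagger (applyReal S u) * applyReal S v = ∑ A, ∑ A', (S (component A u) * S (component A' v)) •
      (dagger (blade ℝ A) * blade ℝ A') := by
  rw [applyReal_eq_sum, applyReal_eq_sum, dagger_sum, Finset.sum_mul_sum]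
  simp only [dagger_smul, smul_mul_smul_comm]
  rfl

theorem integral_exp_smul_dagger_mul (u v : TensorPoly m) :
    ∫ x : EuclideanSpace ℝ (Fin m), Real.exp (-‖x‖ ^ 2 / 2) •
      (dagger (applyReal (evalAt x) u) * applyReal (evalAt x) v) =
        (√(2 * Real.pi) ^ m) • pairing (gaussForm m) u v := by
  have hi : ∀ A A', Integrable fun x : EuclideanSpace ℝ (Fin m) => (Real.exp (-‖x‖ ^ 2 / 2) *
      (evalAt x (component A u) * evalAt x (component A' v))) •
        (dagger (blade ℝ A) * blade ℝ A') := fun A A' => by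
    have h := integrable_exp_mul_eval (component A u * component A' v)
    simp only [map_mul] at h
    simpa only [evalAt_apply] using h.smul_const _
  simp only [dagger_applyReal_mul, Finset.smul_sum, smul_smul]
  rw [integral_finsetSum _ fun A _ => integrable_finsetSum _ fun A' _ => hi A A', pairing_eq_sum,
    Finset.smul_sum]
  refine Finset.sum_congr rfl fun A _ => ?_
  rw [integral_finsetSum _ fun A' _ => hi A A', Finset.smul_sum]
  refine Finset.sum_congr rfl fun A' _ => ?_
  rw [integral_smul_const, gaussForm_eq_integral, smul_smul, ← mul_assoc, mul_inv_cancel₀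
    (by positivity), one_mul]
  simp only [evalAt_apply]

end GaussianIntegrals

/-! ### Moments of the Fock measure and the Fischer form -/

section FockIntegrals

variable {m : ℕ}

/-- The one-dimensional integrand `conj(z) ^ a z ^ b exp(-|z|²) / π`. -/
def fockIntegrandOne (a b : ℕ) (z : ℂ) : ℂ :=
  ((Real.exp (-‖z‖ ^ 2) / Real.pi : ℝ) : ℂ) * (starRingEnd ℂ z ^ a * z ^ b)

theorem integral_norm_pow_mul_exp (n : ℕ) : ∫ z : ℂ, ‖z‖ ^ n * Real.exp (-‖z‖ ^ 2) =
    Real.pi * Real.Gamma ((n + 2) / 2) := by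
  have h := Complex.integral_rpow_mul_exp_neg_rpow (p := 2) (q := n) (by norm_num)
    (by linarith [(Nat.cast_nonneg n : (0 : ℝ) ≤ n)])
  simpa [Real.rpow_natCast, mul_div_assoc] using h

/-- The integral has a known positive value, whereas the integral of a non-integrable function is
zero by convention. -/
theorem integrable_norm_pow_mul_exp (n : ℕ) :
    Integrable fun z : ℂ => ‖z‖ ^ n * Real.exp (-‖z‖ ^ 2) := by
  by_contra h
  have h1 := integral_norm_pow_mul_exp n
  rw [integral_undef h] at h1
  have h2 : 0 < Real.Gamma (((n : ℝ) + 2) / 2) := Real.Gamma_pos_of_pos (by positivity)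
  exact (mul_pos Real.pi_pos h2).ne h1

theorem continuous_fockIntegrandOne (a b : ℕ) : Continuous (fockIntegrandOne a b) := by
  unfold fockIntegrandOne
  fun_prop

theorem integrable_fockIntegrandOne (a b : ℕ) : Integrable (fockIntegrandOne a b) := by
  refine ((integrable_norm_pow_mul_exp (a + b)).div_const Real.pi).mono'
    (continuous_fockIntegrandOne a b).aestronglyMeasurable (Filter.Eventually.of_forall fun z => ?_)
  rw [fockIntegrandOne, norm_mul, norm_mul, norm_pow, norm_pow, RCLike.norm_conj,
    Complex.norm_real, Real.norm_of_nonneg (by positivity), ← pow_add]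
  exact le_of_eq (by ring)

/-- The moments of the one-dimensional Fock measure. -/
def fockMoment (a b : ℕ) : ℝ := if a = b then a.factorial else 0

theorem fockMoment_succ (a b : ℕ) : fockMoment (a + 1) b = b * fockMoment a (b - 1) := by
  unfold fockMoment
  cases b with
  | zero => simp
  | succ b =>
    by_cases h : a = b
    · subst h; simp [Nat.factorial_succ]
    · simp [h]

theorem fockMoment_comm (a b : ℕ) : fockMoment a b = fockMoment b a := by
  unfold fockMoment
  by_cases h : a = b
  · subst h; rfl
  · rw [if_neg h, if_neg (Ne.symm h)]

theorem integral_fockIntegrandOne (a b : ℕ) : ∫ z, fockIntegrandOne a b z = fockMoment a b := by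
  by_cases h : a = b
  · subst h
    have h1 : ∀ z, fockIntegrandOne a a z =
        ((‖z‖ ^ (2 * a) * Real.exp (-‖z‖ ^ 2) / Real.pi : ℝ) : ℂ) := by
      intro z
      rw [fockIntegrandOne, ← mul_pow, Complex.conj_mul', ← pow_mul]
      push_cast
      ring
    rw [funext h1]
    refine (integral_ofReal
      (f := fun z : ℂ => ‖z‖ ^ (2 * a) * Real.exp (-‖z‖ ^ 2) / Real.pi)).trans ?_
    rw [integral_div, integral_norm_pow_mul_exp, mul_div_cancel_left₀ _ Real.pi_ne_zero, fockMoment,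
      if_pos rfl, show (((2 * a : ℕ) : ℝ) + 2) / 2 = a + 1 by push_cast; ring,
      Real.Gamma_nat_eq_factorial]
    rfl
  · have hθ : ((b : ℂ) - a) ≠ 0 := sub_ne_zero.2 (by exact_mod_cast Ne.symm h)
    -- Rotation by this angle multiplies conj(z)^a z^b by exp(iπ) = -1 and preserves the measure, so
    -- the integral equals its negative.
    set c : Circle := Circle.exp (Real.pi / (b - a)) with hc
    have hc1 : starRingEnd ℂ (c : ℂ) ^ a * (c : ℂ) ^ b = -1 := by
      rw [hc, Circle.coe_exp, ← Complex.exp_conj, ← Complex.exp_nat_mul, ← Complex.exp_nat_mul,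
        ← Complex.exp_add, ← Complex.exp_pi_mul_I]
      congr 1
      rw [map_mul, Complex.conj_I, Complex.conj_ofReal]
      push_cast
      field_simp
      ring
    have h1 : ∫ z, fockIntegrandOne a b (rotation c z) = ∫ z, fockIntegrandOne a b z :=
      (rotation c).measurePreserving.integral_comp (rotation c).toHomeomorph.measurableEmbedding _
    have h2 : ∀ z, fockIntegrandOne a b (rotation c z) = -fockIntegrandOne a b z := by
      intro z
      rw [rotation_apply, fockIntegrandOne, fockIntegrandOne, norm_mul, Circle.norm_coe, one_mul,
        map_mul, mul_pow, mul_pow, mul_mul_mul_comm, hc1]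
      ring
    simp only [h2] at h1
    rw [integral_neg, neg_eq_iff_add_eq_zero, ← two_mul, mul_eq_zero] at h1
    rw [h1.resolve_left two_ne_zero, fockMoment, if_neg h, Complex.ofReal_zero]

theorem measurable_fockDensity : Measurable fun z : Fin m → ℂ =>
    ENNReal.ofReal (Real.exp (-∑ j, ‖z j‖ ^ 2) / Real.pi ^ m) := by
  fun_prop

theorem integral_fockMeasure {E : Type*} [NormedAddCommGroup E] [NormedSpace ℝ E]
    (f : (Fin m → ℂ) → E) : ∫ z, f z ∂fockMeasure m =
      ∫ z : Fin m → ℂ, (Real.exp (-∑ j, ‖z j‖ ^ 2) / Real.pi ^ m) • f z := by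
  rw [fockMeasure, integral_withDensity_eq_integral_toReal_smul measurable_fockDensity
    (Filter.Eventually.of_forall fun z => ENNReal.ofReal_lt_top)]
  refine integral_congr_ae (Filter.Eventually.of_forall fun z => ?_)
  simp only
  rw [ENNReal.toReal_ofReal (by positivity)]

theorem integrable_fockMeasure {E : Type*} [NormedAddCommGroup E] [NormedSpace ℝ E]
    {f : (Fin m → ℂ) → E} (hf : Integrable fun z : Fin m → ℂ =>
      (Real.exp (-∑ j, ‖z j‖ ^ 2) / Real.pi ^ m) • f z) : Integrable f (fockMeasure m) := by
  rw [fockMeasure, integrable_withDensity_iff_integrable_smul' measurable_fockDensity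
    (Filter.Eventually.of_forall fun z => ENNReal.ofReal_lt_top)]
  refine hf.congr (Filter.Eventually.of_forall fun z => ?_)
  simp only
  rw [ENNReal.toReal_ofReal (by positivity)]

theorem aeval_monomial_eq (s : Fin m →₀ ℕ) (c : ℝ) (z : Fin m → ℂ) :
    MvPolynomial.aeval z (MvPolynomial.monomial s c) = c * ∏ j, z j ^ s j := by
  rw [MvPolynomial.aeval_monomial, Finsupp.prod_fintype _ _ (by simp)]
  rfl

theorem fockDensity_smul_monomial (s t : Fin m →₀ ℕ) (c d : ℝ) (z : Fin m → ℂ) :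
    (Real.exp (-∑ j, ‖z j‖ ^ 2) / Real.pi ^ m) •
      (starRingEnd ℂ (MvPolynomial.aeval z (MvPolynomial.monomial s c)) *
        MvPolynomial.aeval z (MvPolynomial.monomial t d)) =
      (c * d : ℂ) * ∏ j, fockIntegrandOne (s j) (t j) (z j) := by
  simp only [fockIntegrandOne, aeval_monomial_eq, Finset.prod_mul_distrib, map_mul, map_prod,
    map_pow, Complex.conj_ofReal, Complex.real_smul, ← Complex.ofReal_prod, Finset.prod_div_distrib,
    ← Real.exp_sum, Finset.sum_neg_distrib, Finset.prod_const, Finset.card_univ, Fintype.card_fin]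
  ring

theorem integrable_conj_aeval_mul (p q : ScalarPoly m) :
    Integrable (fun z => starRingEnd ℂ (MvPolynomial.aeval z p) * MvPolynomial.aeval z q)
      (fockMeasure m) := by
  induction p using MvPolynomial.induction_on' with
  | monomial s c =>
    induction q using MvPolynomial.induction_on' with
    | monomial t d =>
      refine integrable_fockMeasure ?_
      simp only [fockDensity_smul_monomial]
      exact (Integrable.fintype_prod (f := fun j => fockIntegrandOne (s j) (t j))
        fun j => integrable_fockIntegrandOne (s j) (t j)).const_mul _
    | add p q hp hq =>
      simp only [map_add, mul_add]
      exact hp.add hq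
  | add p q hp hq =>
    simp only [map_add, add_mul]
    exact hp.add hq

/-- The bilinear form `∫ conj(p) q dμ` for the measure of the Segal-Bargmann space. -/
def fockForm (m : ℕ) : ScalarPoly m →ₗ[ℝ] ScalarPoly m →ₗ[ℝ] ℂ :=
  LinearMap.mk₂ ℝ (fun p q => ∫ z, starRingEnd ℂ (MvPolynomial.aeval z p) *
      MvPolynomial.aeval z q ∂fockMeasure m)
    (fun p p' q => by
      simp only [map_add, add_mul]
      exact integral_add (integrable_conj_aeval_mul p q) (integrable_conj_aeval_mul p' q))
    (fun c p q => by
      simp only [map_smul, Complex.real_smul, map_mul, Complex.conj_ofReal, mul_assoc]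
      exact integral_const_mul _ _)
    (fun p q q' => by
      simp only [map_add, mul_add]
      exact integral_add (integrable_conj_aeval_mul p q) (integrable_conj_aeval_mul p q'))
    (fun c p q => by
      simp only [map_smul, Complex.real_smul, mul_left_comm _ (c : ℂ)]
      exact integral_const_mul _ _)

theorem fockForm_apply (p q : ScalarPoly m) : fockForm m p q =
    ∫ z, starRingEnd ℂ (MvPolynomial.aeval z p) * MvPolynomial.aeval z q ∂fockMeasure m := rfl

theorem fockForm_monomial (s t : Fin m →₀ ℕ) (c d : ℝ) :
    fockForm m (MvPolynomial.monomial s c) (MvPolynomial.monomial t d) =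
      ((c * d * ∏ j, fockMoment (s j) (t j) : ℝ) : ℂ) := by
  rw [fockForm_apply, integral_fockMeasure]
  simp only [fockDensity_smul_monomial]
  rw [integral_const_mul, integral_fintype_prod_volume_eq_prod
    (f := fun j => fockIntegrandOne (s j) (t j))]
  simp only [integral_fockIntegrandOne]
  push_cast
  rfl

/-- The Fischer inner product of real polynomials. -/
def fischerForm (m : ℕ) : ScalarPoly m →ₗ[ℝ] ScalarPoly m →ₗ[ℝ] ℝ :=
  (fockForm m).compr₂ Complex.reLm

theorem fischerForm_monomial (s t : Fin m →₀ ℕ) (c d : ℝ) :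
    fischerForm m (MvPolynomial.monomial s c) (MvPolynomial.monomial t d) =
      c * d * ∏ j, fockMoment (s j) (t j) :=
  congrArg Complex.re (fockForm_monomial s t c d)

theorem monomial_induction₂ {F : Type*} [AddCommGroup F] [Module ℝ F]
    {f g : ScalarPoly m →ₗ[ℝ] ScalarPoly m →ₗ[ℝ] F}
    (h : ∀ s t c d, f (MvPolynomial.monomial s c) (MvPolynomial.monomial t d) =
      g (MvPolynomial.monomial s c) (MvPolynomial.monomial t d)) (p q : ScalarPoly m) :
    f p q = g p q := by
  induction p using MvPolynomial.induction_on' with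
  | monomial s c =>
    induction q using MvPolynomial.induction_on' with
    | monomial t d => exact h s t c d
    | add p q hp hq => rw [map_add, map_add, hp, hq]
  | add p q hp hq => rw [map_add, map_add, LinearMap.add_apply, LinearMap.add_apply, hp, hq]

/-- The polynomials have real coefficients and all Fock moments are real, so taking the real part
loses nothing. -/
theorem fockForm_eq (p q : ScalarPoly m) : fockForm m p q = (fischerForm m p q : ℝ) :=
  monomial_induction₂ (g := (fischerForm m).compr₂ Complex.ofRealCLM.toLinearMap)
    (fun s t c d => by
      rw [fockForm_monomial]
      exact congrArg Complex.ofReal (fischerForm_monomial s t c d).symm) p q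

/-- On monomials adjointness is the factorial recursion `fockMoment_succ` in the j-th variable. -/
theorem isAdjointForm_fischerForm : IsAdjointForm varOp (fischerForm m) where
  symm p q := monomial_induction₂ (g := (fischerForm m).flip) (fun s t c d => by
    rw [LinearMap.flip_apply, fischerForm_monomial, fischerForm_monomial, mul_comm c]
    simp only [fockMoment_comm]) p q
  adjoint j p q := monomial_induction₂ (f := (fischerForm m).comp (varOp j))
    (g := (fischerForm m).compl₂ (partialOp j)) (fun s t c d => by
    have h : MvPolynomial.X j * MvPolynomial.monomial s c =
        MvPolynomial.monomial (s + Finsupp.single j 1) c := by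
      rw [MvPolynomial.monomial_add_single, pow_one, mul_comm]
    rw [LinearMap.comp_apply, LinearMap.compl₂_apply, varOp_apply, partialOp_apply, h,
      MvPolynomial.pderiv_monomial, fischerForm_monomial, fischerForm_monomial,
      prod_eq_mul_prod_erase (fun i n => fockMoment n (t i)) s j (s + Finsupp.single j 1)
        fun i hi => by simp [hi.symm],
      prod_eq_mul_prod_erase (fun i n => fockMoment (s i) n) t j (t - Finsupp.single j 1)
        fun i hi => by simp [hi.symm]]
    simp only [Finsupp.add_apply, Finsupp.tsub_apply, Finsupp.single_eq_same, fockMoment_succ]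
    ring) p q

theorem fischerForm_one_one : fischerForm m 1 1 = 1 := by
  have h := fischerForm_monomial (m := m) 0 0 1 1
  simpa [fockMoment] using h

theorem dagger_applyComplex_mul (S : ScalarPoly m →ₗ[ℝ] ℂ) (u v : TensorPoly m) :
    dagger (applyComplex S u) * applyComplex S v =
      ∑ A, ∑ A', (starRingEnd ℂ (S (component A u)) * S (component A' v)) •
        (dagger (blade ℂ A) * blade ℂ A') := by
  rw [applyComplex_eq_sum, applyComplex_eq_sum, dagger_sum, Finset.sum_mul_sum]
  simp only [dagger_smul, smul_mul_smul_comm]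

theorem integral_dagger_applyComplex_mul (u v : TensorPoly m) :
    ∫ z, dagger (applyComplex (evalAtComplex z) u) * applyComplex (evalAtComplex z) v
      ∂fockMeasure m = complexifyHom m (pairing (fischerForm m) u v) := by
  have hi : ∀ A A', Integrable (fun z => (starRingEnd ℂ (evalAtComplex z (component A u)) *
      evalAtComplex z (component A' v)) • (dagger (blade ℂ A) * blade ℂ A')) (fockMeasure m) :=
    fun A A' => (integrable_conj_aeval_mul (component A u) (component A' v)).smul_const _
  simp only [dagger_applyComplex_mul]
  rw [integral_finsetSum _ fun A _ => integrable_finsetSum _ fun A' _ => hi A A', pairing_eq_sum,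
    map_sum]
  refine Finset.sum_congr rfl fun A _ => ?_
  rw [integral_finsetSum _ fun A' _ => hi A A', map_sum]
  refine Finset.sum_congr rfl fun A' _ => ?_
  rw [integral_smul_const, map_smul, map_mul, complexifyHom_blade, ← dagger_complexifyHom,
    complexifyHom_blade, ← Complex.coe_smul, ← fockForm_eq, fockForm_apply]
  rfl

end FockIntegrals

/-! ### The Dirac operator, Clifford-Hermite polynomials and the normalizing constants -/

section DiracOperator

variable {m : ℕ}

theorem hasLineDerivAt_eval (j : Fin m) (p : ScalarPoly m) (x : EuclideanSpace ℝ (Fin m)) :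
    HasLineDerivAt ℝ (fun y : EuclideanSpace ℝ (Fin m) => MvPolynomial.eval (fun i => y i) p)
      (MvPolynomial.eval (fun i => x i) (MvPolynomial.pderiv j p)) x
      (EuclideanSpace.single j 1) := by
  unfold HasLineDerivAt
  induction p using MvPolynomial.induction_on with
  | C c => simpa using hasDerivAt_const (0 : ℝ) c
  | add p q hp hq =>
    simp only [map_add]
    exact hp.add hq
  | mul_X p i hp =>
    have hX : HasDerivAt (fun t : ℝ => x i + t * (Pi.single j (1 : ℝ) : Fin m → ℝ) i)
        ((Pi.single j (1 : ℝ) : Fin m → ℝ) i) 0 := by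
      simpa using ((hasDerivAt_id (0 : ℝ)).mul_const _).const_add (x i)
    have h := hp.mul hX
    refine (h.congr_deriv ?_).congr_of_eventuallyEq (Filter.Eventually.of_forall fun t => ?_)
    · rw [Derivation.leibniz, MvPolynomial.pderiv_X]
      by_cases hij : i = j
      · subst hij; simp; ring
      · simp [hij, mul_comm]
    · simp [Pi.single_apply]

theorem hasLineDerivAt_exp_norm_sq (j : Fin m) (x : EuclideanSpace ℝ (Fin m)) :
    HasLineDerivAt ℝ (fun y : EuclideanSpace ℝ (Fin m) => Real.exp (-‖y‖ ^ 2 / 2))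
      (-(x j) * Real.exp (-‖x‖ ^ 2 / 2)) x (EuclideanSpace.single j 1) := by
  unfold HasLineDerivAt
  have h1 : HasDerivAt (fun t : ℝ => x + t • (EuclideanSpace.single j 1 : EuclideanSpace ℝ (Fin m)))
      (EuclideanSpace.single j 1) 0 := by
    simpa using ((hasDerivAt_id (0 : ℝ)).smul_const
      (EuclideanSpace.single j 1 : EuclideanSpace ℝ (Fin m))).const_add x
  have h2 := ((h1.norm_sq.neg).div_const 2).exp
  refine h2.congr_deriv ?_
  simp [EuclideanSpace.inner_single_right]
  ring

/-- The product rule: differentiating the Gaussian contributes -x_j, so ∂_j acts on the polynomial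
factor as -(x_j - ∂_j). -/
theorem hasLineDerivAt_exp_smul_applyReal (j : Fin m) (u : TensorPoly m)
    (x : EuclideanSpace ℝ (Fin m)) :
    HasLineDerivAt ℝ (fun y => Real.exp (-‖y‖ ^ 2 / 2) • applyReal (evalAt y) u)
      (-(Real.exp (-‖x‖ ^ 2 / 2) • applyReal (evalAt x ∘ₗ gaussOp j) u)) x
      (EuclideanSpace.single j 1) := by
  simp only [applyReal_eq_sum, Finset.smul_sum, smul_smul, ← Finset.sum_neg_distrib]
  unfold HasLineDerivAt
  refine HasDerivAt.fun_sum fun A _ => ?_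
  have h := (HasDerivAt.mul (hasLineDerivAt_exp_norm_sq j x)
    (hasLineDerivAt_eval j (component A u) x)).smul_const (blade ℝ A)
  simp only [evalAt_apply]
  refine h.congr_deriv ?_
  rw [← neg_smul]
  congr 1
  simp
  ring

theorem hasLineDerivAt_applyReal (j : Fin m) (u : TensorPoly m) (x : EuclideanSpace ℝ (Fin m)) :
    HasLineDerivAt ℝ (fun y => applyReal (evalAt y) u)
      (applyReal (evalAt x ∘ₗ partialOp j) u) x (EuclideanSpace.single j 1) := by
  simp only [applyReal_eq_sum]
  unfold HasLineDerivAt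
  refine HasDerivAt.fun_sum fun A _ => ?_
  simp only [evalAt_apply, LinearMap.comp_apply, partialOp_apply]
  exact HasDerivAt.smul_const (hasLineDerivAt_eval j (component A u) x) (blade ℝ A)

theorem applyReal_cliffOp (S : ScalarPoly m →ₗ[ℝ] ℝ) (L : Fin m → ScalarOp m) (u : TensorPoly m) :
    applyReal S (cliffOp L u) = ∑ j, gen ℝ j * applyReal (S ∘ₗ L j) u := by
  have : applyReal S ∘ₗ cliffOp L =
      ∑ j, LinearMap.mulLeft ℝ (gen ℝ j) ∘ₗ applyReal (S ∘ₗ L j) :=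
    TensorProduct.ext' fun p a => by simp [LinearMap.sum_apply]
  simpa [LinearMap.sum_apply] using LinearMap.congr_fun this u

theorem dirac_exp_smul_applyReal (u : TensorPoly m) :
    dirac (fun y => Real.exp (-‖y‖ ^ 2 / 2) • applyReal (evalAt y) u) =
      fun x => Real.exp (-‖x‖ ^ 2 / 2) • applyReal (evalAt x) (-cliffOp gaussOp u) := by
  funext x
  simp only [dirac, (hasLineDerivAt_exp_smul_applyReal _ u x).lineDeriv, map_neg,
    applyReal_cliffOp, smul_neg, mul_neg, Finset.sum_neg_distrib, Finset.smul_sum, mul_smul_comm]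

theorem dirac_applyReal (u : TensorPoly m) (x : EuclideanSpace ℝ (Fin m)) :
    dirac (fun y => applyReal (evalAt y) u) x = applyReal (evalAt x) (cliffOp partialOp u) := by
  simp only [dirac, (hasLineDerivAt_applyReal _ u x).lineDeriv, applyReal_cliffOp]

theorem dirac_iterate_exp_smul (l : ℕ) (u : TensorPoly m) :
    dirac^[l] (fun y => Real.exp (-‖y‖ ^ 2 / 2) • applyReal (evalAt y) u) =
      fun x => Real.exp (-‖x‖ ^ 2 / 2) •
        applyReal (evalAt x) ((-1 : ℝ) ^ l • (cliffOp gaussOp ^ l) u) := by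
  induction l generalizing u with
  | zero => simp
  | succ l ih =>
    rw [Function.iterate_succ_apply, dirac_exp_smul_applyReal, ih]
    funext x
    rw [pow_succ (cliffOp gaussOp), Module.End.mul_apply, pow_succ (-1 : ℝ)]
    simp only [map_smul, map_neg, mul_neg_one, neg_smul, smul_neg]

theorem hermitePoly_eq (l : ℕ) (P : CliffordPoly m) (x : EuclideanSpace ℝ (Fin m)) :
    hermitePoly l P x = applyReal (evalAt x) ((cliffOp gaussOp ^ l) P.toTensor) := by
  simp only [hermitePoly, evalReal_eq]
  rw [dirac_iterate_exp_smul]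
  beta_reduce
  rw [map_smul, smul_smul, smul_smul, mul_right_comm, mul_assoc, mul_assoc,
    mul_comm (Real.exp (‖x‖ ^ 2 / 2)), mul_assoc, ← Real.exp_add,
    show -‖x‖ ^ 2 / 2 + ‖x‖ ^ 2 / 2 = 0 by ring, Real.exp_zero, mul_one, ← mul_pow]
  norm_num

theorem hermiteFunction_eq (l k : ℕ) (P : CliffordPoly m) (x : EuclideanSpace ℝ (Fin m)) :
    hermiteFunction l k P x = ((√(hermiteGamma m l k))⁻¹ * Real.exp (-‖x‖ ^ 2 / 4)) •
      applyReal (evalAt x) ((cliffOp gaussOp ^ l) P.toTensor) := by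
  rw [hermiteFunction, hermitePoly_eq]

/-! ### Monogenic polynomials as tensors -/

theorem cliffOp_partialOp_toTensor {k : ℕ} {P : CliffordPoly m} (hP : P ∈ monogenics m k) :
    cliffOp partialOp P.toTensor = 0 := by
  refine eq_of_applyReal_evalAt fun x => ?_
  rw [← dirac_applyReal, map_zero, ← hP.2 x]
  simp only [← evalReal_eq]

/-- D² = -Δ acts on each component separately. -/
theorem isHarmonic_of_mem_monogenics {k : ℕ} {P : CliffordPoly m} (hP : P ∈ monogenics m k)
    (A : Finset (Fin m)) : IsHarmonic k (P A) where
  homogeneous := hP.1 A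
  laplace := by
    have h := cliffOp_partialOp_sq P.toTensor
    rw [cliffOp_partialOp_toTensor hP, map_zero, zero_eq_neg] at h
    have h2 := component_scalarOp A (∑ j, partialOp j * partialOp j) P.toTensor
    rw [h, map_zero, component_toTensor] at h2
    simpa [LinearMap.sum_apply] using h2.symm

theorem isMonogenicTensor_of_mem {T : Fin m → ScalarOp m}
    (hT : ∀ k (p : ScalarPoly m), IsHarmonic k p →
      ∑ j, T j (MvPolynomial.pderiv j p) = (k : ℝ) • p)
    {k : ℕ} {P : CliffordPoly m} (hP : P ∈ monogenics m k) :
    IsMonogenicTensor T k P.toTensor where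
  dirac_eq := cliffOp_partialOp_toTensor hP
  number_eq := component_ext fun A => by
    rw [component_scalarOp, map_smul, component_toTensor,
      ← hT k _ (isHarmonic_of_mem_monogenics hP A)]
    simp [numberOp, LinearMap.sum_apply]

theorem pairing_fischerForm_eq {k : ℕ} {P Q : CliffordPoly m} (hP : P ∈ monogenics m k)
    (hQ : Q ∈ monogenics m k) : pairing (fischerForm m) P.toTensor Q.toTensor =
      pairing (gaussForm m) P.toTensor Q.toTensor := by
  rw [pairing_eq_sum, pairing_eq_sum]
  refine Finset.sum_congr rfl fun A _ => Finset.sum_congr rfl fun A' _ => ?_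
  rw [component_toTensor, component_toTensor,
    IsHarmonic.form_eq isAdjointForm_fischerForm isAdjointForm_gaussForm
      (fischerForm_one_one.trans gaussForm_one_one.symm) (fun _ _ h => h.numberOp_varOp)
      (fun _ _ h => h.numberOp_gaussOp) (isHarmonic_of_mem_monogenics hP A)
      (isHarmonic_of_mem_monogenics hQ A')]

/-! ### The Segal-Bargmann transform of the Clifford-Hermite functions -/

theorem applyComplex_gaussFunctional {k : ℕ} {P : CliffordPoly m} (hP : P ∈ monogenics m k)
    (z : Fin m → ℂ) : applyComplex (gaussFunctional z) P.toTensor = P.evalComplex z := by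
  rw [evalComplex_eq, applyComplex_eq_sum, applyComplex_eq_sum]
  refine Finset.sum_congr rfl fun A _ => ?_
  rw [component_toTensor, IsHarmonic.functional_eq (gaussFunctional_one z)
    (gaussFunctional_gaussOp z) (isHarmonic_of_mem_monogenics hP A), evalAtComplex_apply]

theorem complexifyHom_applyReal (x : EuclideanSpace ℝ (Fin m)) (u : TensorPoly m) :
    complexifyHom m (applyReal (evalAt x) u) =
      ∑ A, ((MvPolynomial.eval (fun j => x j) (component A u) : ℝ) : ℂ) • blade ℂ A := by
  rw [applyReal_eq_sum, map_sum]
  simp [complexifyHom_blade]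

theorem integral_gaussKernel_smul (z : Fin m → ℂ) (u : TensorPoly m) :
    (√(2 * Real.pi) ^ m)⁻¹ • ∫ x : EuclideanSpace ℝ (Fin m),
      gaussKernel z x • complexifyHom m (applyReal (evalAt x) u) =
        applyComplex (gaussFunctional z) u := by
  simp only [complexifyHom_applyReal, Finset.smul_sum, smul_smul]
  rw [integral_finsetSum _ fun A _ =>
    (integrable_gaussKernel_mul z (component A u)).smul_const (blade ℂ A), applyComplex_eq_sum,
    Finset.smul_sum]
  refine Finset.sum_congr rfl fun A _ => ?_
  rw [integral_smul_const, gaussFunctional_apply, smul_assoc]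

/-- The factor exp(-|x|²/4) of the Hermite function completes the kernel to `gaussKernel`. The
Gaussian functional then turns each raising operator into left multiplication by the Clifford vector
z, and evaluates the harmonic components of P at z. -/
theorem bargmann_hermiteFunction {l k : ℕ} {P : CliffordPoly m} (hP : P ∈ monogenics m k)
    (z : Fin m → ℂ) : bargmann (hermiteFunction l k P) z =
      (√(hermiteGamma m l k))⁻¹ • vecPowMul l P z := by
  have h : ∀ x : EuclideanSpace ℝ (Fin m),
      Complex.exp (-(∑ j, z j * z j) / 2 + ∑ j, (x j : ℂ) * z j
        - (∑ j, (x j : ℂ) * (x j : ℂ)) / 4) • complexify (hermiteFunction l k P x) =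
      (√(hermiteGamma m l k))⁻¹ • (gaussKernel z x •
        complexifyHom m (applyReal (evalAt x) ((cliffOp gaussOp ^ l) P.toTensor))) := by
    intro x
    rw [complexify_eq, hermiteFunction_eq, map_smul, mul_smul, smul_comm]
    congr 1
    rw [← Complex.coe_smul, smul_smul, Complex.ofReal_exp, ← Complex.exp_add, gaussKernel,
      EuclideanSpace.real_norm_sq_eq]
    congr 2
    push_cast
    simp only [sq]
    ring
  rw [bargmann, integral_congr_ae (Filter.Eventually.of_forall h), integral_smul, smul_comm,
    integral_gaussKernel_smul, applyComplex_cliffOp_pow (gaussFunctional_gaussOp z),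
    applyComplex_gaussFunctional hP, vecPowMul]

/-! ### The normalizing constants -/

/-- From l = 2p to 2p + 1 the Gamma function gains m/2 + k + p; from 2p + 1 to 2p + 2 the factorial
gains p + 1. The power of 2 doubles each factor. -/
theorem hermiteGamma_succ (hm : 1 ≤ m) (l k : ℕ) :
    hermiteGamma m (l + 1) k = lowerCoeff m (l + 1) k * hermiteGamma m l k := by
  have hm' : (0 : ℝ) < m := by exact_mod_cast hm
  rcases Nat.even_or_odd' l with ⟨p, rfl | rfl⟩
  · have e1 : ¬Even (2 * p + 1) := by simp
    have e2 : Even (2 * p) := even_two_mul p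
    have d1 : (2 * p + 1) / 2 = p := by lia
    have d2 : 2 * p / 2 = p := by lia
    simp only [hermiteGamma, lowerCoeff, e1, e2, if_true, if_false, d1, d2]
    rw [Real.Gamma_add_one (by positivity), Real.rpow_add_one (by norm_num)]
    push_cast
    ring
  · have e1 : Even (2 * p + 1 + 1) := ⟨p + 1, by ring⟩
    have e2 : ¬Even (2 * p + 1) := by simp
    have d1 : (2 * p + 1 + 1) / 2 = p + 1 := by lia
    have d2 : (2 * p + 1) / 2 = p := by lia
    simp only [hermiteGamma, lowerCoeff, e1, e2, if_true, if_false, d1, d2]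
    rw [Nat.factorial_succ, show 2 * ((p + 1 : ℕ) : ℝ) + (m : ℝ) / 2 + k =
      2 * p + (m : ℝ) / 2 + k + 1 + 1 by push_cast; ring, Real.rpow_add_one (by norm_num) (_ + 1),
      show (m : ℝ) / 2 + k + ((p + 1 : ℕ) : ℝ) = (m : ℝ) / 2 + k + p + 1 by push_cast; ring]
    push_cast
    ring

theorem hermiteGamma_eq (hm : 1 ≤ m) (l k : ℕ) :
    hermiteGamma m l k = lowerProd m l k * hermiteGamma m 0 k := by
  induction l with
  | zero => simp [lowerProd]
  | succ l ih => rw [hermiteGamma_succ hm, ih, lowerProd, lowerProd, Finset.prod_range_succ]; ring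

theorem hermiteGamma_pos (hm : 1 ≤ m) (l k : ℕ) : 0 < hermiteGamma m l k := by
  have hm' : (0 : ℝ) < m := by exact_mod_cast hm
  have h1 : 0 < Real.Gamma ((m : ℝ) / 2) := Real.Gamma_pos_of_pos (by positivity)
  have h2 : 0 < Real.Gamma ((m : ℝ) / 2 + k + (l / 2 : ℕ)) := Real.Gamma_pos_of_pos (by positivity)
  have h3 : 0 < Real.Gamma ((m : ℝ) / 2 + k + (l / 2 : ℕ) + 1) :=
    Real.Gamma_pos_of_pos (by positivity)
  unfold hermiteGamma
  split_ifs <;> positivity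

theorem hermiteGamma_zero (k : ℕ) : hermiteGamma m 0 k = √(2 * Real.pi) ^ m *
    (2 ^ k * Real.Gamma ((m : ℝ) / 2 + k) / Real.Gamma ((m : ℝ) / 2)) := by
  have h : (2 : ℝ) ^ ((m : ℝ) / 2) = √2 ^ m := by
    rw [Real.sqrt_eq_rpow, ← Real.rpow_natCast, ← Real.rpow_mul (by norm_num)]
    congr 1
    ring
  simp only [hermiteGamma, Even.zero, if_true]
  rw [Real.sqrt_mul (by norm_num), mul_pow, ← h]
  simp only [Nat.zero_div, Nat.cast_zero, mul_zero, zero_add, Nat.factorial_zero, Nat.cast_one,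
    mul_one, add_zero]
  rw [Real.rpow_add (by norm_num), Real.rpow_natCast]
  ring

end DiracOperator

/-! ### Polar coordinates and orthonormality on both sides -/

section PolarCoordinates

variable {m : ℕ}

theorem integral_polar {E F : Type*} [NormedAddCommGroup E] [NormedSpace ℝ E]
    [FiniteDimensional ℝ E] [MeasurableSpace E] [BorelSpace E] [Nontrivial E]
    [NormedAddCommGroup F] [NormedSpace ℝ F] (μ : Measure E) [μ.IsAddHaarMeasure] (g : ℝ → ℝ)
    (f : E → F) (n : ℕ) (hf : ∀ (r : ℝ) (x : E), f (r • x) = r ^ n • f x) :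
    ∫ x, g ‖x‖ • f x ∂μ =
      (∫ r in Set.Ioi (0 : ℝ), r ^ (Module.finrank ℝ E - 1 + n) * g r) •
        ∫ x : Metric.sphere (0 : E) 1, f x ∂μ.toSphere := by
  calc
    _ = ∫ x : ({(0)}ᶜ : Set E), g ‖x.1‖ • f x.1 ∂(μ.comap (↑)) := by
      rw [integral_subtype_comap (measurableSet_singleton _).compl fun x => g ‖x‖ • f x,
        restrict_compl_singleton]
    _ = ∫ y : Metric.sphere (0 : E) 1 × Set.Ioi (0 : ℝ), (y.2.1 ^ n * g y.2.1) • f y.1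
        ∂μ.toSphere.prod (.volumeIoiPow (Module.finrank ℝ E - 1)) := by
      rw [← μ.measurePreserving_homeomorphUnitSphereProd.integral_comp
        (Homeomorph.measurableEmbedding _)]
      refine integral_congr_ae (Filter.Eventually.of_forall fun x => ?_)
      have hx : (0 : ℝ) < ‖x.1‖ := norm_pos_iff.2 x.2
      -- Homogeneity is applied to x as its norm times its direction, which separates the radial
      -- factor.
      have h := hf ‖x.1‖ (‖x.1‖⁻¹ • x.1)
      rw [smul_inv_smul₀ hx.ne'] at h
      simp only [homeomorphUnitSphereProd_apply_fst_coe, homeomorphUnitSphereProd_apply_snd_coe]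
      rw [mul_comm, mul_smul, ← h]
    _ = (∫ r : Set.Ioi (0 : ℝ), r.1 ^ n * g r.1 ∂.volumeIoiPow (Module.finrank ℝ E - 1)) •
        ∫ x : Metric.sphere (0 : E) 1, f x ∂μ.toSphere := by
      rw [← integral_prod_swap]
      exact integral_prod_smul (fun r : Set.Ioi (0 : ℝ) => r.1 ^ n * g r.1)
        (fun x : Metric.sphere (0 : E) 1 => f x)
    _ = _ := by
      congr 1
      simp only [Measure.volumeIoiPow, ENNReal.ofReal]
      rw [integral_withDensity_eq_integral_smul,
        integral_subtype_comap measurableSet_Ioi fun a =>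
          Real.toNNReal (a ^ (Module.finrank ℝ E - 1)) • (a ^ n * g a)]
      · refine setIntegral_congr_fun measurableSet_Ioi fun x hx => ?_
        rw [NNReal.smul_def, Real.coe_toNNReal _ (pow_nonneg hx.out.le _), smul_eq_mul, pow_add,
          mul_assoc]
      · exact (measurable_subtype_coe.pow_const _).real_toNNReal

theorem integral_pow_mul_exp_neg_sq (n : ℕ) :
    ∫ r in Set.Ioi (0 : ℝ), r ^ n * Real.exp (-r ^ 2 / 2) =
      2 ^ (((n : ℝ) + 1) / 2) * (1 / 2) * Real.Gamma (((n : ℝ) + 1) / 2) := by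
  have h := integral_rpow_mul_exp_neg_mul_rpow (p := 2) (q := n) (b := 1 / 2) (by norm_num)
    (by linarith [(Nat.cast_nonneg n : (0 : ℝ) ≤ n)]) (by norm_num)
  have e : (1 / 2 : ℝ) ^ (-((n : ℝ) + 1) / 2) = 2 ^ (((n : ℝ) + 1) / 2) := by
    rw [one_div, Real.inv_rpow (by norm_num), ← Real.rpow_neg (by norm_num)]
    congr 1
    ring
  rw [e] at h
  rw [← h]
  refine setIntegral_congr_fun measurableSet_Ioi fun x _ => ?_
  simp only [Real.rpow_natCast]
  norm_num
  left
  ring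

theorem eval_smul_of_isHomogeneous {k : ℕ} {p : ScalarPoly m} (hp : p.IsHomogeneous k) (r : ℝ)
    (x : EuclideanSpace ℝ (Fin m)) : MvPolynomial.eval (fun j => (r • x) j) p =
      r ^ k * MvPolynomial.eval (fun j => x j) p := by
  rw [MvPolynomial.eval_eq', MvPolynomial.eval_eq', Finset.mul_sum]
  refine Finset.sum_congr rfl fun s hs => ?_
  have h : ∑ j, s j = k := by
    have := hp (MvPolynomial.mem_support_iff.1 hs)
    simpa [Finsupp.weight_apply, Finsupp.sum_fintype] using this
  simp only [PiLp.smul_apply, smul_eq_mul, mul_pow, Finset.prod_mul_distrib,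
    Finset.prod_pow_eq_pow_sum, h]
  ring

/-- The integrand P†Q is homogeneous of degree 2k, so the Gaussian integral splits into a radial
Gamma integral and the sphere integral. -/
theorem pairing_gaussForm_eq_sphereInner (hm : 1 ≤ m) {k : ℕ} {P Q : CliffordPoly m}
    (hP : ∀ A, (P A).IsHomogeneous k) (hQ : ∀ A, (Q A).IsHomogeneous k) :
    √(2 * Real.pi) ^ m • pairing (gaussForm m) P.toTensor Q.toTensor =
      hermiteGamma m 0 k • sphereInner P Q := by
  have : Nonempty (Fin m) := ⟨⟨0, hm⟩⟩
  set σ := (volume : Measure (EuclideanSpace ℝ (Fin m))).toSphere with hσ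
  have hm' : (0 : ℝ) < m := by exact_mod_cast hm
  have hG : 0 < Real.Gamma ((m : ℝ) / 2) := Real.Gamma_pos_of_pos (by positivity)
  have hdim : Module.finrank ℝ (EuclideanSpace ℝ (Fin m)) - 1 = m - 1 := by simp
  have hsmul : ∀ {P : CliffordPoly m}, (∀ A, (P A).IsHomogeneous k) →
      ∀ (r : ℝ) (x : EuclideanSpace ℝ (Fin m)), P.evalReal (r • x) = r ^ k • P.evalReal x := by
    intro P hP r x
    simp only [CliffordPoly.evalReal, Finset.smul_sum, smul_smul]
    exact Finset.sum_congr rfl fun A _ => by rw [eval_smul_of_isHomogeneous (hP A)]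
  have h1 := integral_polar (volume : Measure (EuclideanSpace ℝ (Fin m)))
    (fun r => Real.exp (-r ^ 2 / 2)) (fun x => dagger (P.evalReal x) * Q.evalReal x) (2 * k)
    (fun r x => by
      rw [hsmul hP, hsmul hQ, dagger_smul, smul_mul_smul_comm, two_mul, pow_add]
      rfl)
  -- The constant function 1 in place of P†Q expresses the area of the sphere through the total
  -- Gaussian mass, so no separate area formula is needed.
  have h0 := integral_polar (volume : Measure (EuclideanSpace ℝ (Fin m)))
    (fun r => Real.exp (-r ^ 2 / 2)) (fun _ => (1 : ℝ)) 0 (by simp)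
  have hone : ∫ x : EuclideanSpace ℝ (Fin m), Real.exp (-‖x‖ ^ 2 / 2) • (1 : ℝ) =
      √(2 * Real.pi) ^ m := by
    have h := gaussForm_eq_integral (m := m) 1 1
    rw [gaussForm_one_one, eq_comm, inv_mul_eq_iff_eq_mul₀ (by positivity), mul_one] at h
    simpa using h
  rw [hone, integral_pow_mul_exp_neg_sq, hdim, integral_const, smul_eq_mul, smul_eq_mul,
    mul_one] at h0
  simp only [evalReal_eq] at h1
  rw [integral_exp_smul_dagger_mul, integral_pow_mul_exp_neg_sq, hdim] at h1
  have e0 : (((m - 1 + 0 : ℕ) : ℝ) + 1) / 2 = (m : ℝ) / 2 := by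
    rw [add_zero, Nat.cast_sub hm]; push_cast; ring
  have e1 : (((m - 1 + 2 * k : ℕ) : ℝ) + 1) / 2 = (m : ℝ) / 2 + k := by
    rw [Nat.cast_add, Nat.cast_sub hm]; push_cast; ring
  rw [e0] at h0
  rw [e1] at h1
  have hS : σ.real Set.univ ≠ 0 := by
    rintro h
    rw [h, mul_zero] at h0
    exact (pow_pos (Real.sqrt_pos.2 (by positivity)) m).ne' h0
  have hsph : sphereInner P Q = (σ.real Set.univ)⁻¹ •
      ∫ x : Metric.sphere (0 : EuclideanSpace ℝ (Fin m)) 1,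
        dagger (applyReal (evalAt x) P.toTensor) * applyReal (evalAt x) Q.toTensor ∂σ := by
    rw [sphereInner, cliffordInner, sphereMeasure, integral_smul_measure, ENNReal.toReal_inv]
    simp only [evalReal_eq]
    rfl
  rw [h1, hsph, smul_smul, hermiteGamma_zero, h0, Real.rpow_add (by norm_num), Real.rpow_natCast]
  congr 1
  field_simp
  rfl

/-! ### Orthonormality -/

/-- This is the common source of both orthonormality relations. Different l are separated by
`pairing_pow`, different k by the number operator, and different j by the given basis; the lowering
factors times γ_{0,k} make up γ_{l,k}. -/
theorem pairing_pow_monogenicBasis (hm : 1 ≤ m) {T : Fin m → ScalarOp m} (hT : IsRaising T)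
    (hN : ∀ k (p : ScalarPoly m), IsHarmonic k p →
      ∑ j, T j (MvPolynomial.pderiv j p) = (k : ℝ) • p)
    {B : ScalarPoly m →ₗ[ℝ] ScalarPoly m →ₗ[ℝ] ℝ} (hB : IsAdjointForm T B)
    (hBG : ∀ {k : ℕ} {P Q : CliffordPoly m}, P ∈ monogenics m k → Q ∈ monogenics m k →
      pairing B P.toTensor Q.toTensor = pairing (gaussForm m) P.toTensor Q.toTensor)
    {d : ℕ → ℕ} {P : (k : ℕ) → Fin (d k) → CliffordPoly m} (hP : ∀ k, IsMonogenicBasis k (P k))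
    (l k l' k' : ℕ) (j : Fin (d k)) (j' : Fin (d k')) :
    ((√(hermiteGamma m l k))⁻¹ * (√(hermiteGamma m l' k'))⁻¹ * √(2 * Real.pi) ^ m) •
      pairing B ((cliffOp T ^ l) (P k j).toTensor) ((cliffOp T ^ l') (P k' j').toTensor) =
      if ((l, ⟨k, j⟩) : ℕ × (Σ k, Fin (d k))) = (l', ⟨k', j'⟩) then 1 else 0 := by
  have hu := isMonogenicTensor_of_mem hN ((hP k).mem j)
  have hv := isMonogenicTensor_of_mem hN ((hP k').mem j')
  rw [pairing_pow hT hB hu hv]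
  by_cases hl : l = l'
  swap
  · rw [if_neg hl, smul_zero, if_neg (by simp [hl])]
  subst hl
  rw [if_pos rfl]
  by_cases hk : k = k'
  swap
  · rw [pairing_eq_zero_of_ne hB hk hu hv, smul_zero, smul_zero, if_neg (by simp [hk])]
  subst hk
  have hpos := hermiteGamma_pos hm l k
  rw [hBG ((hP k).mem j) ((hP k).mem j'), smul_smul, mul_right_comm,
    mul_smul _ (√(2 * Real.pi) ^ m),
    pairing_gaussForm_eq_sphereInner hm ((hP k).mem j).1 ((hP k).mem j').1, (hP k).orthonormal,
    smul_smul, mul_assoc, ← hermiteGamma_eq hm, ← mul_inv, Real.mul_self_sqrt hpos.le,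
    inv_mul_cancel₀ hpos.ne', one_smul]
  simp

theorem integral_hermiteFunction (hm : 1 ≤ m) {d : ℕ → ℕ} {P : (k : ℕ) → Fin (d k) → CliffordPoly m}
    (hP : ∀ k, IsMonogenicBasis k (P k)) (l k l' k' : ℕ) (j : Fin (d k)) (j' : Fin (d k')) :
    ∫ x, dagger (hermiteFunction l k (P k j) x) * hermiteFunction l' k' (P k' j') x =
      if ((l, ⟨k, j⟩) : ℕ × (Σ k, Fin (d k))) = (l', ⟨k', j'⟩) then 1 else 0 := by
  rw [← pairing_pow_monogenicBasis hm isRaising_gaussOp (fun _ _ h => h.numberOp_gaussOp)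
    isAdjointForm_gaussForm (fun _ _ => rfl) hP, mul_smul, ← integral_exp_smul_dagger_mul,
    ← integral_smul]
  refine integral_congr_ae (Filter.Eventually.of_forall fun x => ?_)
  beta_reduce
  rw [hermiteFunction_eq, hermiteFunction_eq, dagger_smul, smul_mul_smul_comm, smul_smul,
    show -‖x‖ ^ 2 / 2 = -‖x‖ ^ 2 / 4 + -‖x‖ ^ 2 / 4 by ring, Real.exp_add]
  congr 1
  simp only [conj_trivial]
  ring

theorem integral_vecPowMul (hm : 1 ≤ m) {d : ℕ → ℕ} {P : (k : ℕ) → Fin (d k) → CliffordPoly m}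
    (hP : ∀ k, IsMonogenicBasis k (P k)) (l k l' k' : ℕ) (j : Fin (d k)) (j' : Fin (d k')) :
    ∫ z, dagger (√(√(2 * Real.pi) ^ m / hermiteGamma m l k) • vecPowMul l (P k j) z) *
      (√(√(2 * Real.pi) ^ m / hermiteGamma m l' k') • vecPowMul l' (P k' j') z) ∂fockMeasure m =
      if ((l, ⟨k, j⟩) : ℕ × (Σ k, Fin (d k))) = (l', ⟨k', j'⟩) then 1 else 0 := by
  have h := pairing_pow_monogenicBasis hm isRaising_varOp (fun _ _ h => h.numberOp_varOp)
    isAdjointForm_fischerForm (fun hP hQ => pairing_fischerForm_eq hP hQ) hP l k l' k' j j'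
  have h2 := congrArg (complexifyHom m) h
  rw [map_smul, ← integral_dagger_applyComplex_mul, ← integral_smul, apply_ite (complexifyHom m),
    map_one, map_zero] at h2
  rw [← h2]
  refine integral_congr_ae (Filter.Eventually.of_forall fun z => ?_)
  beta_reduce
  rw [dagger_real_smul, smul_mul_smul_comm, vecPowMul_eq, vecPowMul_eq,
    Real.sqrt_div (by positivity), Real.sqrt_div (by positivity)]
  congr 1
  have : √(√(2 * Real.pi) ^ m) * √(√(2 * Real.pi) ^ m) = √(2 * Real.pi) ^ m :=
    Real.mul_self_sqrt (by positivity)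
  linear_combination (√(hermiteGamma m l k))⁻¹ * (√(hermiteGamma m l' k'))⁻¹ * this

end PolarCoordinates

/-! ### From Clifford modules to Hilbert spaces -/

section HilbertModule

variable {m : ℕ}

/-- Inside the closed span, itself a Hilbert space, the family has trivial orthogonal complement and
is therefore a Hilbert basis. -/
theorem hasSum_inner_smul_of_mem_closure_span {H ι : Type*} [NormedAddCommGroup H]
    [InnerProductSpace ℂ H] [CompleteSpace H] {v : ι → H} (hv : Orthonormal ℂ v) {x : H}
    (hx : x ∈ (Submodule.span ℂ (Set.range v)).topologicalClosure) :
    HasSum (fun i => inner ℂ (v i) x • v i) x := by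
  set K := (Submodule.span ℂ (Set.range v)).topologicalClosure with hK
  have hvK : ∀ i, v i ∈ K := fun i =>
    Submodule.le_topologicalClosure _ (Submodule.subset_span ⟨i, rfl⟩)
  have : CompleteSpace K := (Submodule.isClosed_topologicalClosure _).completeSpace_coe
  let w : ι → K := fun i => ⟨v i, hvK i⟩
  have hw : Orthonormal ℂ w :=
    (LinearIsometry.orthonormal_comp_iff (v := w) K.subtypeₗᵢ).1 hv
  have hbot : (Submodule.span ℂ (Set.range w))ᗮ = ⊥ := by
    rw [Submodule.eq_bot_iff]
    intro y hy
    have h1 : (y : H) ∈ (Submodule.span ℂ (Set.range v))ᗮ := by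
      rw [Submodule.mem_orthogonal]
      intro u hu
      induction hu using Submodule.span_induction with
      | mem u hu =>
        obtain ⟨i, rfl⟩ := hu
        exact (Submodule.mem_orthogonal _ _).1 hy (w i) (Submodule.subset_span ⟨i, rfl⟩)
      | zero => exact inner_zero_left _
      | add u u' _ _ hu hu' => rw [inner_add_left, hu, hu', add_zero]
      | smul c u _ hu => rw [inner_smul_left, hu, mul_zero]
    rw [← Submodule.orthogonal_closure] at h1
    have h2 : inner ℂ (y : H) (y : H) = 0 := (Submodule.mem_orthogonal _ _).1 h1 y y.2
    exact Subtype.ext (inner_self_eq_zero.1 h2)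
  have hs := (HilbertBasis.mkOfOrthogonalEqBot hw hbot).hasSum_repr ⟨x, hx⟩
  have hs' := hs.mapL K.subtypeL
  simpa only [HilbertBasis.repr_apply_apply, HilbertBasis.coe_mkOfOrthogonalEqBot, map_smul,
    Submodule.subtypeL_apply, Submodule.coe_inner, w] using hs'

/-- The inner product on the Clifford algebra that is given by the scalar part of `a† b`. -/
abbrev scalarInnerProductSpace (m : ℕ) : InnerProductSpace ℂ (Cl ℂ m) where
  toNormedSpace := inferInstance
  inner a b := scalarPart ℂ m (dagger a * b)
  norm_sq_eq_re_inner a := by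
    rw [norm_sq_eq, scalarPart_dagger_mul, map_sum]
    refine Finset.sum_congr rfl fun A _ => ?_
    rw [Complex.conj_mul', ← Complex.ofReal_pow]
    rfl
  conj_inner_symm a b := by
    rw [scalarPart_dagger_mul, scalarPart_dagger_mul, map_sum]
    simp [mul_comm]
  add_left a b c := by rw [dagger_add, add_mul, map_add]
  smul_left a b c := by rw [dagger_smul, smul_mul_assoc, map_smul, smul_eq_mul]

/-- The coefficient of a blade as a continuous linear functional. -/
def coeffCLM (A : Finset (Fin m)) : Cl ℂ m →L[ℂ] ℂ :=
  LinearMap.toContinuousLinearMap ((bladeBasis ℂ m).coord A)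

theorem coeffCLM_apply (A : Finset (Fin m)) (a : Cl ℂ m) :
    coeffCLM A a = (bladeBasis ℂ m).repr a A := rfl

theorem dagger_mul_eq_sum (a b : Cl ℂ m) : dagger a * b =
    ∑ A, ∑ A', (starRingEnd ℂ (coeffCLM A a) * coeffCLM A' b) •
      (dagger (blade ℂ A) * blade ℂ A') := by
  conv_lhs => rw [← sum_repr_smul_blade a, ← sum_repr_smul_blade b]
  rw [dagger_sum, Finset.sum_mul_sum]
  simp only [dagger_smul, smul_mul_smul_comm, coeffCLM_apply]

variable {X : Type} [MeasurableSpace X] {μ : Measure X}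

theorem integrable_conj_mul {f g : X → ℂ} (hf : MemLp f 2 μ) (hg : MemLp g 2 μ) :
    Integrable (fun x => starRingEnd ℂ (f x) * g x) μ :=
  hf.star.integrable_mul hg

theorem memLp_coeff (F : Lp (Cl ℂ m) 2 μ) (A : Finset (Fin m)) :
    MemLp (fun x => coeffCLM A (F x)) 2 μ := (coeffCLM A).comp_memLp' (Lp.memLp F)

theorem integrable_dagger_mul (F G : Lp (Cl ℂ m) 2 μ) :
    Integrable (fun x => dagger (F x) * G x) μ := by
  rw [funext fun x => dagger_mul_eq_sum (F x) (G x)]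
  exact integrable_finsetSum _ fun A _ => integrable_finsetSum _ fun A' _ =>
    (integrable_conj_mul (memLp_coeff F A) (memLp_coeff G A')).smul_const _

theorem coeFn_rightMul {𝕜 : Type} [RCLike 𝕜] (F : Lp (Cl 𝕜 m) 2 μ) (a : Cl 𝕜 m) :
    rightMul F a =ᵐ[μ] fun x => F x * a :=
  (mulRightCLM a).coeFn_compLp' F

theorem rightMul_one (F : Lp (Cl ℂ m) 2 μ) : rightMul F 1 = F := by
  refine Lp.ext ((coeFn_rightMul F 1).trans (Filter.Eventually.of_forall fun x => ?_))
  exact mul_one _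

/-- The map `a ↦ F a` into the right module `L²`. -/
def rightMulₗ (F : Lp (Cl ℂ m) 2 μ) : Cl ℂ m →ₗ[ℂ] Lp (Cl ℂ m) 2 μ where
  toFun := rightMul F
  map_add' a b := by
    refine Lp.ext ?_
    filter_upwards [coeFn_rightMul F (a + b), coeFn_rightMul F a, coeFn_rightMul F b,
      Lp.coeFn_add (rightMul F a) (rightMul F b)] with x h1 h2 h3 h4
    rw [h1, h4, Pi.add_apply, h2, h3, mul_add]
  map_smul' c a := by
    refine Lp.ext ?_
    filter_upwards [coeFn_rightMul F (c • a), coeFn_rightMul F a,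
      Lp.coeFn_smul c (rightMul F a)] with x h1 h2 h3
    rw [h1, RingHom.id_apply, h3, Pi.smul_apply, h2, mul_smul_comm]

theorem rightMulₗ_apply (F : Lp (Cl ℂ m) 2 μ) (a : Cl ℂ m) : rightMulₗ F a = rightMul F a := rfl

theorem rightMul_eq_sum (F : Lp (Cl ℂ m) 2 μ) (a : Cl ℂ m) :
    rightMul F a = ∑ A, (bladeBasis ℂ m).repr a A • rightMul F (blade ℂ A) := by
  conv_lhs => rw [← sum_repr_smul_blade a]
  simp only [← rightMulₗ_apply, map_sum, map_smul]

theorem cliffordInner_rightMul (F G : Lp (Cl ℂ m) 2 μ) (a : Cl ℂ m) :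
    cliffordInner μ F (rightMul G a) = cliffordInner μ F G * a := by
  have h := (mulRightCLM a).integral_comp_comm (integrable_dagger_mul F G)
  refine Eq.trans ?_ h
  refine integral_congr_ae ?_
  filter_upwards [coeFn_rightMul G a] with x hx
  rw [hx, ← mul_assoc]
  rfl

/-- Since (F e_A)† G = e_A† F† G, the scalar inner product with F e_A reads off the e_A coefficient
of ⟨F, G⟩. -/
theorem integral_scalarPart_dagger_rightMul_mul (F G : Lp (Cl ℂ m) 2 μ) (A : Finset (Fin m)) :
    ∫ x, scalarPart ℂ m (dagger (rightMul F (blade ℂ A) x) * G x) ∂μ =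
      (bladeBasis ℂ m).repr (cliffordInner μ F G) A := by
  have h := (coeffCLM A).integral_comp_comm (integrable_dagger_mul F G)
  refine Eq.trans ?_ h
  refine integral_congr_ae ?_
  filter_upwards [coeFn_rightMul F (blade ℂ A)] with x hx
  rw [hx, dagger_mul, mul_assoc, scalarPart_dagger_blade_mul]
  rfl

theorem isOrthonormalBasis_closure_span {I : Type} [DecidableEq I] {Ψ : I → Lp (Cl ℂ m) 2 μ}
    (hΨ : IsOrthonormalFamily Ψ) :
    IsOrthonormalBasis (Submodule.span ℂ (Set.range fun p : I × Finset (Fin m) =>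
      rightMul (Ψ p.1) (blade ℂ p.2))).topologicalClosure Ψ where
  mem i := Submodule.le_topologicalClosure _ (Submodule.subset_span
    ⟨(i, ∅), by simp only [blade_empty, rightMul_one]⟩)
  orthonormal := hΨ
  hasSum F hF := by
    have hc : CompleteSpace (Cl ℂ m) := FiniteDimensional.complete ℂ (Cl ℂ m)
    -- This inner product induces the existing norm, so L² becomes a complex Hilbert space without
    -- changing its topology.
    let _ := scalarInnerProductSpace m
    have hinner : ∀ (i : I) (A : Finset (Fin m)) (G : Lp (Cl ℂ m) 2 μ),
        inner ℂ (rightMul (Ψ i) (blade ℂ A)) G =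
          (bladeBasis ℂ m).repr (cliffordInner μ (Ψ i) G) A := fun i A G =>
      (L2.inner_def _ _).trans (integral_scalarPart_dagger_rightMul_mul (Ψ i) G A)
    have ho : Orthonormal ℂ fun p : I × Finset (Fin m) => rightMul (Ψ p.1) (blade ℂ p.2) := by
      rw [orthonormal_iff_ite]
      rintro ⟨i, A⟩ ⟨j, A'⟩
      rw [hinner, cliffordInner_rightMul, hΨ i j]
      by_cases hij : i = j
      · subst hij
        simp [repr_blade, Finsupp.single_apply, eq_comm]
      · simp [hij]
    have hs := hasSum_inner_smul_of_mem_closure_span ho hF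
    -- For fixed i the finite sum over blades reassembles Ψ_i ⟨Ψ_i, F⟩ from its coefficients.
    refine hs.prod_fiberwise fun i => ?_
    rw [rightMul_eq_sum]
    simp only [hinner]
    exact hasSum_fintype _

end HilbertModule

/-! ### Square integrability and the span of the basis functions -/

section Bases

variable {m : ℕ}

theorem continuous_aeval (p : ScalarPoly m) :
    Continuous fun z : Fin m → ℂ => MvPolynomial.aeval z p := by
  induction p using MvPolynomial.induction_on with
  | C c => simpa using continuous_const
  | add p q hp hq =>
    simp only [map_add]
    exact hp.add hq
  | mul_X p j hp =>
    simp only [map_mul, MvPolynomial.aeval_X]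
    exact hp.mul (continuous_apply j)

theorem memLp_aeval (p : ScalarPoly m) :
    MemLp (fun z : Fin m → ℂ => MvPolynomial.aeval z p) 2 (fockMeasure m) := by
  rw [memLp_two_iff_integrable_sq_norm (continuous_aeval p).aestronglyMeasurable]
  refine (integrable_conj_aeval_mul p p).norm.congr (Filter.Eventually.of_forall fun z => ?_)
  simp only [norm_mul, RCLike.norm_conj, sq]

theorem memLp_vecPowMul (l : ℕ) (P : CliffordPoly m) (c : ℝ) :
    MemLp (fun z => c • vecPowMul l P z) 2 (fockMeasure m) := by
  refine MemLp.const_smul (f := fun z => vecPowMul l P z) ?_ c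
  simp only [vecPowMul_eq, applyComplex_eq_sum]
  refine memLp_finsetSum _ fun A _ => ?_
  exact (ContinuousLinearMap.toSpanSingleton ℂ (blade ℂ A)).comp_memLp' (memLp_aeval _)

theorem memLp_hermiteFunction (l k : ℕ) (P : CliffordPoly m) :
    MemLp (hermiteFunction l k P) 2 (volume : Measure (EuclideanSpace ℝ (Fin m))) := by
  have h1 : ∀ p : ScalarPoly m, MemLp (fun x : EuclideanSpace ℝ (Fin m) =>
      Real.exp (-‖x‖ ^ 2 / 4) * evalAt x p) 2 := by
    intro p
    have hc : Continuous fun x : EuclideanSpace ℝ (Fin m) =>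
        Real.exp (-‖x‖ ^ 2 / 4) * evalAt x p := by
      simp only [evalAt_apply]
      refine Continuous.mul (by fun_prop) ?_
      exact (MvPolynomial.continuous_eval p).comp (PiLp.continuous_ofLp 2 _)
    rw [memLp_two_iff_integrable_sq_norm hc.aestronglyMeasurable]
    refine (integrable_exp_mul_eval (p * p)).congr (Filter.Eventually.of_forall fun x => ?_)
    simp only [evalAt_apply, map_mul, Real.norm_eq_abs, sq_abs]
    rw [show -‖x‖ ^ 2 / 2 = -‖x‖ ^ 2 / 4 + -‖x‖ ^ 2 / 4 by ring, Real.exp_add]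
    ring
  have h2 : hermiteFunction l k P = fun x => ∑ A, ((√(hermiteGamma m l k))⁻¹ *
      (Real.exp (-‖x‖ ^ 2 / 4) * evalAt x (component A ((cliffOp gaussOp ^ l) P.toTensor)))) •
        blade ℝ A := by
    funext x
    rw [hermiteFunction_eq, applyReal_eq_sum, Finset.smul_sum]
    simp only [smul_smul, mul_assoc]
  rw [h2]
  refine memLp_finsetSum _ fun A _ => ?_
  exact (ContinuousLinearMap.toSpanSingleton ℝ (blade ℝ A)).comp_memLp' ((h1 _).const_mul _)

/-- An expansion valid at real points is an identity of polynomials, hence persists at complex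
points. -/
theorem vecPowMul_eq_sum {d : ℕ} {P : Fin d → CliffordPoly m} {Q : CliffordPoly m}
    {a : Fin d → Cl ℝ m} (h : ∀ x, Q.evalReal x = ∑ j, (P j).evalReal x * a j) (l : ℕ)
    (z : Fin m → ℂ) : vecPowMul l Q z = ∑ j, vecPowMul l (P j) z * complexifyHom m (a j) := by
  have hQ : Q.toTensor = ∑ j, mulRightOp (a j) (P j).toTensor := by
    refine eq_of_applyReal_evalAt fun x => ?_
    rw [← evalReal_eq, h, map_sum]
    simp only [applyReal_mulRightOp, evalReal_eq]
  simp only [vecPowMul, mul_assoc, ← Finset.mul_sum]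
  congr 1
  rw [evalComplex_eq, hQ, map_sum]
  simp only [applyComplex_mulRightOp, evalComplex_eq]

/-- The spans agree already before closure: each monogenic is a finite right combination of the
basis with real Clifford coefficients, and the complex coefficients expand in blades. -/
theorem segalBargmannModule_eq (hm : 1 ≤ m) {d : ℕ → ℕ}
    {P : (k : ℕ) → Fin (d k) → CliffordPoly m} (hP : ∀ k, IsMonogenicBasis k (P k))
    {Ψ : ℕ × (Σ k, Fin (d k)) → Lp (Cl ℂ m) 2 (fockMeasure m)}
    (hΨ : ∀ l k j, Ψ (l, ⟨k, j⟩) =ᵐ[fockMeasure m] fun z =>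
      √(√(2 * Real.pi) ^ m / hermiteGamma m l k) • vecPowMul l (P k j) z) :
    segalBargmannModule m = (Submodule.span ℂ (Set.range
      fun p : (ℕ × (Σ k, Fin (d k))) × Finset (Fin m) =>
        rightMul (Ψ p.1) (blade ℂ p.2))).topologicalClosure := by
  rw [segalBargmannModule]
  congr 1
  refine le_antisymm (Submodule.span_le.2 ?_) (Submodule.span_le.2 ?_)
  · rintro F ⟨l, k, Q, a, hQ, hF⟩
    obtain ⟨b, hb⟩ := (hP k).span Q hQ
    have hc : √(√(2 * Real.pi) ^ m / hermiteGamma m l k) ≠ 0 :=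
      (Real.sqrt_pos.2 (div_pos (by positivity) (hermiteGamma_pos hm l k))).ne'
    set c := √(√(2 * Real.pi) ^ m / hermiteGamma m l k) with hcdef
    -- The scalar c⁻¹ undoes the normalization of Ψ.
    have hF' : F = ∑ j, rightMul (Ψ (l, ⟨k, j⟩))
        (((c⁻¹ : ℝ) : ℂ) • (complexifyHom m (b j) * a)) := by
      refine Lp.ext ?_
      have h1 : ∀ᵐ z ∂fockMeasure m, ∀ j,
          rightMul (Ψ (l, ⟨k, j⟩))
        (((c⁻¹ : ℝ) : ℂ) • (complexifyHom m (b j) * a)) z =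
            vecPowMul l (P k j) z * (complexifyHom m (b j) * a) := by
        rw [ae_all_iff]
        intro j
        filter_upwards [coeFn_rightMul (Ψ (l, ⟨k, j⟩))
          (((c⁻¹ : ℝ) : ℂ) • (complexifyHom m (b j) * a)), hΨ l k j] with z h1 h2
        rw [h1, h2, ← hcdef, Complex.coe_smul, smul_mul_smul_comm, mul_inv_cancel₀ hc, one_smul]
      filter_upwards [hF, h1, Lp.coeFn_finsetSum Finset.univ fun j => rightMul (Ψ (l, ⟨k, j⟩))
        (((c⁻¹ : ℝ) : ℂ) • (complexifyHom m (b j) * a))] with z h2 h3 h4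
      rw [h2, h4, vecPowMul_eq_sum hb, Finset.sum_mul]
      simp only [Finset.sum_apply, h3, mul_assoc]
    rw [hF']
    refine Submodule.sum_mem _ fun j _ => ?_
    rw [rightMul_eq_sum]
    exact Submodule.sum_mem _ fun A _ => Submodule.smul_mem _ _
      (Submodule.subset_span ⟨((l, ⟨k, j⟩), A), rfl⟩)
  · rintro _ ⟨⟨⟨l, k, j⟩, A⟩, rfl⟩
    refine Submodule.subset_span ⟨l, k, P k j,
      √(√(2 * Real.pi) ^ m / hermiteGamma m l k) • blade ℂ A, (hP k).mem j, ?_⟩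
    filter_upwards [coeFn_rightMul (Ψ (l, ⟨k, j⟩)) (blade ℂ A), hΨ l k j] with z h1 h2
    rw [h1, h2, smul_mul_assoc, mul_smul_comm]

end Bases

end SegalBargmann
end

/-! ### The orthonormal basis and the transform of the Clifford-Hermite functions -/

theorem corollary5p4 (m : ℕ) (hm : 1 ≤ m) (d : ℕ → ℕ)
    (P : (k : ℕ) → Fin (d k) → CliffordPoly m) (hP : ∀ k, IsMonogenicBasis k (P k)) :
    (∃ Ψ : ℕ × (Σ k, Fin (d k)) → Lp (Cl ℂ m) 2 (fockMeasure m),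
      (∀ l k j, Ψ (l, ⟨k, j⟩) =ᵐ[fockMeasure m] fun z =>
        √(√(2 * Real.pi) ^ m / hermiteGamma m l k) • vecPowMul l (P k j) z) ∧
      (∀ l k j, Ψ (l, ⟨k, j⟩) =ᵐ[fockMeasure m] fun z =>
        √(√(2 * Real.pi) ^ m) • bargmann (hermiteFunction l k (P k j)) z) ∧
      IsOrthonormalBasis (segalBargmannModule m) Ψ) ∧
    (∃ Φ : ℕ × (Σ k, Fin (d k)) →
        Lp (Cl ℝ m) 2 (volume : Measure (EuclideanSpace ℝ (Fin m))),
      (∀ l k j, Φ (l, ⟨k, j⟩) =ᵐ[volume] hermiteFunction l k (P k j)) ∧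
      IsOrthonormalFamily Φ) ∧
    ∀ l k j z, bargmann (hermiteFunction l k (P k j)) z =
      (√(hermiteGamma m l k))⁻¹ • vecPowMul l (P k j) z := by
  let Ψ : ℕ × (Σ k, Fin (d k)) → Lp (Cl ℂ m) 2 (fockMeasure m) := fun i =>
    (memLp_vecPowMul i.1 (P i.2.1 i.2.2)
      √(√(2 * Real.pi) ^ m / hermiteGamma m i.1 i.2.1)).toLp _
  have hΨ : ∀ l k j, Ψ (l, ⟨k, j⟩) =ᵐ[fockMeasure m] fun z =>
      √(√(2 * Real.pi) ^ m / hermiteGamma m l k) • vecPowMul l (P k j) z :=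
    fun l k j => MemLp.coeFn_toLp _
  refine ⟨⟨Ψ, hΨ, ?_, ?_⟩,
    ⟨fun i => (memLp_hermiteFunction i.1 i.2.1 (P i.2.1 i.2.2)).toLp _, ?_, ?_⟩, ?_⟩
  · intro l k j
    refine (hΨ l k j).trans (Filter.Eventually.of_forall fun z => ?_)
    beta_reduce
    rw [bargmann_hermiteFunction ((hP k).mem j), smul_smul, Real.sqrt_div (by positivity),
      div_eq_mul_inv]
  · rw [segalBargmannModule_eq hm hP hΨ]
    refine isOrthonormalBasis_closure_span ?_
    rintro ⟨l, k, j⟩ ⟨l', k', j'⟩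
    rw [← integral_vecPowMul hm hP l k l' k' j j']
    refine integral_congr_ae ?_
    filter_upwards [hΨ l k j, hΨ l' k' j'] with z h1 h2
    rw [h1, h2]
  · exact fun l k j => MemLp.coeFn_toLp _
  · rintro ⟨l, k, j⟩ ⟨l', k', j'⟩
    rw [← integral_hermiteFunction hm hP l k l' k' j j']
    refine integral_congr_ae ?_
    filter_upwards [(memLp_hermiteFunction l k (P k j)).coeFn_toLp,
      (memLp_hermiteFunction l' k' (P k' j')).coeFn_toLp] with x h1 h2
    rw [h1, h2]
  · exact fun l k j z => bargmann_hermiteFunction ((hP k).mem j) z
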